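/- **Setting.** An SSP-MDP has a finite non-empty set $\mathcal S$ of $S$ non-goal states, a finite set $\mathcal A$ of $A$ actions, an absorbing goal $g\notin\mathcal S$ and unknown transition laws $p(\cdot\mid s,a)$ on $\mathcal S'=\mathcal S\cup\{g\}$; a policy is a map $\pi:\mathcal S\to\mathcal A$, and $\tau_\pi(s)$ is the number of steps $\pi$ needs to reach $g$ from $s$. Assume that some policy reaches $g$ almost surely from every state. Let $D=\max_s\min_\pi\mathbb E[\tau_\pi(s)]$ (SSP-diameter) and $\Gamma=\max_{s,a}\|p(\cdot\mid s,a)\|_0$. A generative model returns, at each call at $(s,a)$, an independent sample of $p(\cdot\mid s,a)$. Let $\epsilon\in(0,1]$ and $\delta\in(0,1)$, with $\delta\le 1/2$ in the degenerate case $S=A=1$. **Confidence sets and EVI.** With $N(s,a)$ samples at $(s,a)$, $N^+=\max\{1,N\}$ and empirical frequencies $\widehat p$, put $$\beta(s,a,s')=4\sqrt{\frac{\widehat p(s'\mid s,a)}{N^+(s,a)}\log\frac{SAN^+(s,a)}{\delta}}+\frac{28\log\frac{SAN^+(s,a)}{\delta}}{N^+(s,a)},$$ and let $\mathcal B(s,a)$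 be the set of probability vectors $q$ on $\mathcal S'$ with $|q(s')-\widehat p(s'\mid s,a)|\le\beta(s,a,s')$ for all $s'$. EVI with unit costs and precision $\mu$ iterates $v_0=0$, $v_{i+1}(s)=\min_a\{1+\min_{q\in\mathcal B(s,a)}\sum_{s'\in\mathcal S}q(s')v_i(s')\}$ and returns $v_i$ for the first $i$ with $\|v_{i+1}-v_i\|_\infty\le\mu$. **Diameter subroutine**, started with $W:=W_0$, where $W_0\in\{\tfrac12,1\}$. Repeat: set $W\leftarrow 2W$ and $\eta:=\epsilon/W$; at each $(s,a)$ keep the old samples and draw new ones, one at a time, until $\sum_{s'\in\mathcal S'}\beta(s,a,s')\le\eta/2$; compute $\widetilde v$ by EVI with unit costs and precision $\epsilon/2$ on all samples collected so far; stop as soon as $\|\widetilde v\|_\infty\le W$. Output $\widehat D:=\big(1+2\eta(1+\epsilon)\|\widetilde v\|_\infty\big)(1+\epsilon)\|\widetilde v\|_\infty$. **Lemma.** $D<\infty$, and with probability at least $1-\delta$ the subroutine stops and * the total number of calls to the generative model is $\widetilde O\big(D^2\Gamma SA/\epsilon^2+DS^2A/\epsilon\big)$, that is, at most $$C\Big(\frac{D^2\Gamma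 SA}{\epsilon^2}+\frac{DS^2A}{\epsilon}\Big)\Big(1+\log\frac{DSA}{\epsilon\delta}\Big)^k$$ for absolute constants $C>0$ and $k\in\mathbb N$; * the number of iterations is at most $\log_2\big(D(1+\epsilon)/W_0\big)+1$, which is $\log_2(D(1+\epsilon))+1$ for $W_0=1$ and $\log_2(D(1+\epsilon))+2$ for $W_0=\tfrac12$; * $D\le\widehat D\le\big(1+2\epsilon(1+\epsilon)\big)(1+\epsilon)D$. -/

import Mathlib

open MeasureTheory ProbabilityTheory
open scoped ENNReal

noncomputable section

namespace SSP

/-- States of a stochastic shortest path problem: `some s` is the non-goal state `s`,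
`none` is the goal. The finite state space carries the discrete σ-algebra. -/
instance instMeasurableSpaceOption (S : Type*) : MeasurableSpace (Option S) := ⊤

/-- An SSP-MDP with non-goal states `S` and actions `A`. The goal `none` is absorbing and
cost-free, so only the transitions and the costs at non-goal states are data. -/
structure MDP (S A : Type*) [Fintype S] where
  /-- `p s a s'` is the probability of moving to `s'` when playing `a` in `s` -/
  p : S → A → Option S → ℝ
  /-- the costs -/
  c : S → A → ℝ
  p_mem : ∀ s a, p s a ∈ stdSimplex ℝ (Option S)
  c_mem : ∀ s a, c s a ∈ Set.Icc (0 : ℝ) 1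

namespace MDP

variable {S A : Type*} [Fintype S] (M : MDP S A)

/-- Law of the next state when the stationary deterministic policy `π` is used;
the goal is absorbing. -/
def stepMeasure (π : S → A) : Option S → Measure (Option S)
  | none => Measure.dirac none
  | some s => ∑ y, ENNReal.ofReal (M.p s (π s) y) • Measure.dirac y

/-- The one-step Markov kernel of a policy. -/
def step (π : S → A) : Kernel (Option S) (Option S) where
  toFun := M.stepMeasure π
  measurable' := measurable_from_top

instance isMarkovKernel_step (π : S → A) : IsMarkovKernel (M.step π) where
  isProbabilityMeasure x := by
    cases x with
    | none =>
      change IsProbabilityMeasure (Measure.dirac none)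
      infer_instance
    | some s =>
      constructor
      change (∑ y, ENNReal.ofReal (M.p s (π s) y) • Measure.dirac y) Set.univ = 1
      have h := M.p_mem s (π s)
      simp only [Measure.coe_finsetSum, Finset.sum_apply, Measure.smul_apply, measure_univ,
        smul_eq_mul, mul_one]
      rw [← ENNReal.ofReal_sum_of_nonneg (fun y _ => h.1 y), h.2, ENNReal.ofReal_one]

/-- The same kernel, reading the current state off the history up to time `n`. -/
def stepHist (π : S → A) (n : ℕ) : Kernel (Π _ : Finset.Iic n, Option S) (Option S) :=
  (M.step π).comap (fun h => h ⟨n, Finset.mem_Iic.2 le_rfl⟩) (measurable_pi_apply _)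

instance isMarkovKernel_stepHist (π : S → A) (n : ℕ) : IsMarkovKernel (M.stepHist π n) := by
  unfold stepHist
  infer_instance

/-- Law of the trajectory `x 0, x 1, x 2, …` under the policy `π` started at `x 0 = s`. -/
def pathMeasure (π : S → A) (s : S) : Measure (ℕ → Option S) :=
  Kernel.traj (X := fun _ => Option S) (M.stepHist π) 0 (fun _ => some s)

end MDP

/-- Number of steps a trajectory needs to reach the goal (`∞` if it never does). -/
def hittingTime {S : Type*} (x : ℕ → Option S) : ℝ≥0∞ :=
  ⨅ (t : ℕ) (_ : x t = none), (t : ℝ≥0∞)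

namespace MDP

variable {S A : Type*} [Fintype S] (M : MDP S A)

/-- `𝔼[τ_π(s)]`, the expected time to reach the goal. -/
def expTime (π : S → A) (s : S) : ℝ≥0∞ :=
  ∫⁻ x, hittingTime x ∂(M.pathMeasure π s)

/-- A policy is proper if it reaches the goal almost surely from every state. -/
def IsProper (π : S → A) : Prop :=
  ∀ s, ∀ᵐ x ∂(M.pathMeasure π s), ∃ t, x t = none

/-- The SSP-diameter `max_s min_π 𝔼[τ_π(s)]`. -/
def diameter : ℝ≥0∞ :=
  ⨆ s : S, ⨅ π : S → A, M.expTime π s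

/-- The maximal support size of the transition laws. -/
def branching [Fintype A] : ℕ :=
  Finset.univ.sup fun sa : S × A => (Function.support (M.p sa.1 sa.2)).ncard

end MDP

/-- A generative model: `X s a n` is the answer to the `n`-th call at `(s, a)`; all answers are
independent, and those at `(s, a)` have law `p(· | s, a)`. -/
structure IsGenerativeModel {S A Ω : Type*} [Fintype S] [MeasurableSpace Ω]
    (M : MDP S A) (P : Measure Ω) (X : S → A → ℕ → Ω → Option S) : Prop where
  measurable : ∀ s a n, Measurable (X s a n)
  law : ∀ s a n y, P (X s a n ⁻¹' {y}) = ENNReal.ofReal (M.p s a y)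
  indep : iIndepFun (fun (i : S × A × ℕ) => X i.1 i.2.1 i.2.2) P

section Algorithm

/- Below, `ξ s a n` is the realized answer to the `n`-th call of the generative model at `(s, a)`,
and `N s a` is the number of calls made so far at `(s, a)`. -/

variable {S A : Type*} [Fintype S] [Fintype A] [DecidableEq S]

/-- Empirical frequency `p̂(y)` of `y` among the first `n` samples in the list `x`. -/
def empirical (x : ℕ → Option S) (n : ℕ) (y : Option S) : ℝ :=
  (((Finset.range n).filter fun k => x k = y).card : ℝ) / (max 1 n : ℕ)

/-- The logarithmic term `log (S A N⁺ / δ)`. -/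
def logTerm (S A : Type*) [Fintype S] [Fintype A] (δ : ℝ) (n : ℕ) : ℝ :=
  Real.log ((Fintype.card S : ℝ) * Fintype.card A * (max 1 n : ℕ) / δ)

/-- The Bernstein confidence radius `β(s, a, y)` after `n` samples at `(s, a)`. -/
def radius (δ : ℝ) (ξ : S → A → ℕ → Option S) (s : S) (a : A) (n : ℕ) (y : Option S) : ℝ :=
  4 * √(empirical (ξ s a) n y / (max 1 n : ℕ) * logTerm S A δ n)
    + 28 * logTerm S A δ n / (max 1 n : ℕ)

/-- The transition laws at `(s, a)` of the plausible models: probability vectors on `S ∪ {g}` with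
every coordinate within its confidence radius of the empirical frequency. -/
def plausible (δ : ℝ) (ξ : S → A → ℕ → Option S) (s : S) (a : A) (n : ℕ) : Set (Option S → ℝ) :=
  {q | q ∈ stdSimplex ℝ (Option S) ∧
    ∀ y, |q y - empirical (ξ s a) n y| ≤ radius δ ξ s a n y}

/-- The extended optimal Bellman operator
`v ↦ min_a { c(s, a) + min_{q plausible} ∑_{s' ∈ S} q(s') v(s') }`. -/
def bellman (δ : ℝ) (ξ : S → A → ℕ → Option S) (N : S → A → ℕ) (c : S → A → ℝ) (v : S → ℝ) :
    S → ℝ := fun s =>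
  ⨅ a : A, c s a +
    sInf ((fun q : Option S → ℝ => ∑ s' : S, q (some s') * v s') '' plausible δ ξ s a (N s a))

/-- The iterates of extended value iteration, started from `0`. -/
def eviIter (δ : ℝ) (ξ : S → A → ℕ → Option S) (N : S → A → ℕ) (c : S → A → ℝ) (j : ℕ) : S → ℝ :=
  (bellman δ ξ N c)^[j] 0

/-- The value vector returned by extended value iteration with precision `μ`: the first iterate
`v_j` with `‖v_{j+1} - v_j‖∞ ≤ μ` (the norm of `S → ℝ` is the supremum norm). -/
def evi (δ : ℝ) (ξ : S → A → ℕ → Option S) (N : S → A → ℕ) (c : S → A → ℝ) (μ : ℝ) : S → ℝ :=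
  eviIter δ ξ N c
    (sInf {j | ‖eviIter δ ξ N c (j + 1) - eviIter δ ξ N c j‖ ≤ μ})

/- The while loop of the diameter subroutine, unrolled: index `i ≥ 1` is the `i`-th execution of
its body, index `0` the initialization. `W₀` is the initial value of the guess. -/

/-- The guess `W` in iteration `i`; it is doubled at the start of every iteration. -/
def guess (W₀ : ℝ) (i : ℕ) : ℝ := W₀ * 2 ^ i

/-- The accuracy `η = ε / W` in iteration `i`. -/
def accuracy (ε W₀ : ℝ) (i : ℕ) : ℝ := ε / guess W₀ i

/-- Number of samples at each state-action pair at the end of iteration `i`: iteration `i + 1`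
keeps the old samples and draws new ones at `(s, a)`, one by one, until the Bernstein bound
`∑_y β(s, a, y)` on `‖p̂(· | s, a) - p(· | s, a)‖₁` is at most `η / 2`. -/
def counts (ε δ W₀ : ℝ) (ξ : S → A → ℕ → Option S) : ℕ → S → A → ℕ
  | 0 => fun _ _ => 0
  | i + 1 => fun s a =>
      sInf {n | counts ε δ W₀ ξ i s a ≤ n ∧ ∑ y, radius δ ξ s a n y ≤ accuracy ε W₀ (i + 1) / 2}

/-- The optimistic vector of iteration `i`: extended value iteration with unit costs and
precision `ε / 2` on the samples collected so far. -/
def vec (ε δ W₀ : ℝ) (ξ : S → A → ℕ → Option S) (i : ℕ) : S → ℝ :=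
  evi δ ξ (counts ε δ W₀ ξ i) (fun _ _ => 1) (ε / 2)

/-- The subroutine stops after exactly `j` executions of the loop body: `j ≥ 1` is the first
iteration in which the test `‖v‖∞ > W` fails. -/
def StopsAfter (ε δ W₀ : ℝ) (ξ : S → A → ℕ → Option S) (j : ℕ) : Prop :=
  1 ≤ j ∧ ‖vec ε δ W₀ ξ j‖ ≤ guess W₀ j ∧
    ∀ i, 1 ≤ i → i < j → guess W₀ i < ‖vec ε δ W₀ ξ i‖

/-- Total number of calls to the generative model made in the first `j` iterations. -/
def totalSamples (ε δ W₀ : ℝ) (ξ : S → A → ℕ → Option S) (j : ℕ) : ℕ :=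
  ∑ s, ∑ a, counts ε δ W₀ ξ j s a

/-- The output `D̂ = (1 + 2 η (1 + ε) ‖v‖∞) (1 + ε) ‖v‖∞` if the subroutine stops after `j`
iterations. -/
def output (ε δ W₀ : ℝ) (ξ : S → A → ℕ → Option S) (j : ℕ) : ℝ :=
  (1 + 2 * accuracy ε W₀ j * (1 + ε) * ‖vec ε δ W₀ ξ j‖) * (1 + ε) * ‖vec ε δ W₀ ξ j‖

end Algorithm

end SSP

end

noncomputable section

namespace SSP

open Filter Topology

/-! Randomness enters only once. With probability at least 1 - δ, every empirical frequency, at all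
sample sizes simultaneously, is within half its confidence radius of the truth, and no sample leaves
the support of its law (`exists_accurate_event`). The Chernoff failure probability at size n is of
order (δ/(SAn))², summable in n, so adaptively chosen sample sizes are harmless. The rest is
deterministic on this event.

Optimism: the true laws are plausible, so the j-th iterate of EVI is at most the j-step truncated
expected hitting time of every policy, whence ‖v‖ ≤ D (`Accurate.eviIter_le_diameter`). A guess of
at least D passes the test, so the final guess is at most 2D. This bounds the number of iterations
and gives η ≥ ε/(2D).

Converse: the greedy policy π of the final v satisfies c + P_π v ≤ v under the true laws, with c = 1
- ε/2 - (3/8)η‖v‖; here ε/2 is the precision of EVI and the last term is the model error. A drift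
argument (`expTime_le_of_drift`) yields D ≤ ‖v‖/c. The stopping test says η‖v‖ ≤ ε, so c > 0 and the
inflation in the output dominates 1/c (`le_inflated`). Accuracy at half the radius matters: whole
radii would turn 3/8 into 1/2, and c could vanish at ε = 1.

Sample size: with l = log(SAn/δ)/n, Cauchy–Schwarz over at most Γ successors bounds the summed radii
by 4√(Γl) + 28(S+1)l, so about Γ/η² + S/η samples per pair suffice up to a logarithm. -/

instance instDiscreteMeasurableSpaceOption (S : Type*) : DiscreteMeasurableSpace (Option S) :=
  ⟨fun _ => trivial⟩

/-! ### Hitting times, survival probabilities and drift. -/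

namespace MDP

variable {S A : Type*} [Fintype S] (M : MDP S A)

lemma p_nonneg (s : S) (a : A) (y : Option S) : 0 ≤ M.p s a y := (M.p_mem s a).1 y

lemma sum_p (s : S) (a : A) : ∑ y, M.p s a y = 1 := (M.p_mem s a).2

instance (π : S → A) (s : S) : IsProbabilityMeasure (M.pathMeasure π s) := by
  unfold pathMeasure; infer_instance

/-- The Markov property of the trajectory at time `t`. -/
lemma lintegral_pathMeasure_succ (π : S → A) (s : S) (t : ℕ) (G : Option S → Option S → ℝ≥0∞) :
    ∫⁻ x, G (x t) (x (t + 1)) ∂M.pathMeasure π s =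
      ∫⁻ x, ∫⁻ y, G (x t) y ∂M.step π (x t) ∂M.pathMeasure π s := by
  have hG : Measurable (Function.uncurry G) := Measurable.of_discrete
  let last : (Π _ : Finset.Iic t, Option S) → Option S := fun h => h ⟨t, Finset.mem_Iic.2 le_rfl⟩
  have hlast : Measurable last := measurable_pi_apply _
  let F : (Π _ : Finset.Iic t, Option S) × Option S → ℝ≥0∞ := fun z => G (last z.1) z.2
  have hF : Measurable F := hG.comp ((hlast.comp measurable_fst).prodMk measurable_snd)
  have h := Kernel.partialTraj_compProd_eq_map_traj (X := fun _ => Option S)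
    (κ := M.stepHist π) (Nat.zero_le t) (x₀ := fun _ => some s)
  have h1 : ∫⁻ x, G (x t) (x (t + 1)) ∂M.pathMeasure π s =
      ∫⁻ z, F z ∂((M.pathMeasure π s).map
        (fun x => (Preorder.frestrictLe t x, x (t + 1)))) := by
    rw [lintegral_map hF (by fun_prop)]
    rfl
  have h2 : (M.pathMeasure π s).map (fun x => (Preorder.frestrictLe t x, x (t + 1))) =
      (Kernel.partialTraj (X := fun _ => Option S) (M.stepHist π) 0 t (fun _ => some s)) ⊗ₘ
        (M.stepHist π t) := h.symm
  rw [h1, h2, Measure.lintegral_compProd hF, ← Kernel.traj_map_frestrictLe_apply,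
    lintegral_map (Measurable.lintegral_kernel_prod_right hF) (by fun_prop)]
  rfl

lemma pathMeasure_zero (π : S → A) (s : S) (G : Option S → ℝ≥0∞) :
    ∫⁻ x, G (x 0) ∂M.pathMeasure π s = G (some s) := by
  have hG : Measurable G := Measurable.of_discrete
  unfold pathMeasure
  rw [Kernel.lintegral_traj (X := fun _ => Option S) (f := fun x => G (x 0)) _
    (hG.comp (measurable_pi_apply 0))]
  simp [Function.updateFinset]

lemma lintegral_step_some (π : S → A) (s : S) (g : Option S → ℝ≥0∞) :
    ∫⁻ y, g y ∂M.step π (some s) = ∑ y, ENNReal.ofReal (M.p s (π s) y) * g y := by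
  change ∫⁻ y, g y ∂(∑ y, ENNReal.ofReal (M.p s (π s) y) • Measure.dirac y) = _
  rw [lintegral_finsetSum_measure]
  simp [lintegral_smul_measure]

lemma lintegral_step_none (π : S → A) (g : Option S → ℝ≥0∞) :
    ∫⁻ y, g y ∂M.step π none = g none := by
  change ∫⁻ y, g y ∂(Measure.dirac none) = _
  simp

/-- The substochastic transition operator of a policy on the non-goal states. -/
def transit (π : S → A) (v : S → ℝ) : S → ℝ := fun s => ∑ s', M.p s (π s) (some s') * v s'

/-- The probability that the goal has not been reached after `t` steps. -/
def survival (π : S → A) (t : ℕ) : S → ℝ := (M.transit π)^[t] 1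

lemma transit_mono (π : S → A) {v w : S → ℝ} (h : v ≤ w) : M.transit π v ≤ M.transit π w :=
  fun _ => Finset.sum_le_sum fun s' _ => mul_le_mul_of_nonneg_left (h s') (M.p_nonneg _ _ _)

lemma transit_nonneg (π : S → A) {v : S → ℝ} (h : 0 ≤ v) : 0 ≤ M.transit π v :=
  fun _ => Finset.sum_nonneg fun s' _ => mul_nonneg (M.p_nonneg _ _ _) (h s')

lemma transit_add (π : S → A) (v w : S → ℝ) :
    M.transit π (v + w) = M.transit π v + M.transit π w := by
  ext s; simp [transit, mul_add, Finset.sum_add_distrib]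

lemma transit_smul (π : S → A) (c : ℝ) (v : S → ℝ) :
    M.transit π (c • v) = c • M.transit π v := by
  ext s; simp [transit, Finset.mul_sum, mul_left_comm]

lemma transit_sum (π : S → A) {ι : Type*} (t : Finset ι) (v : ι → S → ℝ) :
    M.transit π (∑ i ∈ t, v i) = ∑ i ∈ t, M.transit π (v i) := by
  classical
  induction t using Finset.induction_on with
  | empty => ext s; simp [transit]
  | insert i t hi ih => rw [Finset.sum_insert hi, Finset.sum_insert hi, transit_add, ih]

lemma survival_zero (π : S → A) : M.survival π 0 = 1 := rfl

lemma survival_succ (π : S → A) (t : ℕ) :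
    M.survival π (t + 1) = M.transit π (M.survival π t) :=
  Function.iterate_succ_apply' _ _ _

lemma survival_nonneg (π : S → A) (t : ℕ) : 0 ≤ M.survival π t := by
  induction t with
  | zero => exact fun _ => zero_le_one
  | succ t ih => rw [survival_succ]; exact M.transit_nonneg π ih

/-- Extension of a value vector by `0` at the goal. -/
def extend (v : S → ℝ) : Option S → ℝ≥0∞
  | none => 0
  | some s => ENNReal.ofReal (v s)

lemma lintegral_step_extend (π : S → A) {v : S → ℝ} (hv : 0 ≤ v) (x : Option S) :
    ∫⁻ y, extend v y ∂M.step π x = extend (M.transit π v) x := by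
  cases x with
  | none => rw [lintegral_step_none]; rfl
  | some s =>
    rw [lintegral_step_some, Fintype.sum_option]
    simp only [extend, mul_zero, zero_add, transit]
    rw [ENNReal.ofReal_sum_of_nonneg fun i _ => mul_nonneg (M.p_nonneg _ _ _) (hv i)]
    exact Finset.sum_congr rfl fun i _ => (ENNReal.ofReal_mul (M.p_nonneg _ _ _)).symm

lemma lintegral_extend (π : S → A) (s : S) (t : ℕ) {v : S → ℝ} (hv : 0 ≤ v) :
    ∫⁻ x, extend v (x t) ∂M.pathMeasure π s = ENNReal.ofReal ((M.transit π)^[t] v s) := by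
  induction t generalizing v with
  | zero => rw [pathMeasure_zero]; rfl
  | succ t ih =>
    rw [M.lintegral_pathMeasure_succ π s t (fun _ y => extend v y)]
    simp_rw [M.lintegral_step_extend π hv]
    rw [ih (M.transit_nonneg π hv), Function.iterate_succ_apply]

lemma ae_absorbing (π : S → A) (s : S) :
    ∀ᵐ x ∂M.pathMeasure π s, ∀ t, x t = none → x (t + 1) = none := by
  classical
  rw [ae_all_iff]
  intro t
  let G : Option S → Option S → ℝ≥0∞ := fun a b => if a = none ∧ b ≠ none then 1 else 0
  have hG : Measurable (Function.uncurry G) := Measurable.of_discrete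
  have h : ∫⁻ x, G (x t) (x (t + 1)) ∂M.pathMeasure π s = 0 := by
    rw [lintegral_pathMeasure_succ]
    have : ∀ z : Option S, ∫⁻ y, G z y ∂M.step π z = 0 := by
      intro z
      cases z with
      | none => rw [lintegral_step_none]; simp [G]
      | some s => simp [G]
    simp [this]
  have hm : Measurable fun x : ℕ → Option S => G (x t) (x (t + 1)) :=
    hG.comp (f := fun x : ℕ → Option S => (x t, x (t + 1)))
      ((measurable_pi_apply t).prodMk (measurable_pi_apply (t + 1)))
  rw [lintegral_eq_zero_iff hm] at h
  filter_upwards [h] with x hx hxt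
  by_contra hne
  simp [G, hxt, hne] at hx

-- On an absorbed path, the hitting time counts the times spent outside the goal, and `extend 1` is
-- the indicator of being outside it.
omit [Fintype S] in
lemma hittingTime_eq_tsum {x : ℕ → Option S} (hx : ∀ t, x t = none → x (t + 1) = none) :
    hittingTime x = ∑' t, extend (1 : S → ℝ) (x t) := by
  classical
  have hmono : ∀ t u, x t = none → t ≤ u → x u = none := by
    intro t u ht hu
    induction u, hu using Nat.le_induction with
    | base => exact ht
    | succ u _ ih => exact hx u ih
  have hval : ∀ t, x t ≠ none → extend (1 : S → ℝ) (x t) = 1 := by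
    intro t ht
    obtain ⟨s, hs⟩ := Option.ne_none_iff_exists'.1 ht
    simp [hs, extend]
  by_cases hex : ∃ t, x t = none
  · have hT := Nat.find_spec hex
    set T := Nat.find hex with hTdef
    have h1 : hittingTime x = T := by
      apply le_antisymm
      · exact iInf₂_le T hT
      · refine le_iInf₂ fun t ht => ?_
        exact_mod_cast Nat.find_min' hex ht
    have h2 : ∑' t, extend (1 : S → ℝ) (x t) = ∑ t ∈ Finset.range T, (1 : ℝ≥0∞) := by
      rw [tsum_eq_sum (s := Finset.range T)]
      · exact Finset.sum_congr rfl fun t ht =>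
          hval t (Nat.find_min hex (Finset.mem_range.1 ht))
      · intro t ht
        rw [hmono T t hT (by simpa using ht)]
        rfl
    rw [h1, h2]; simp
  · push Not at hex
    have h1 : hittingTime x = ∞ := by
      simp [hittingTime, hex]
    rw [h1, tsum_congr fun t => hval t (hex t), ENNReal.tsum_const]
    simp

lemma expTime_eq_tsum (π : S → A) (s : S) :
    M.expTime π s = ∑' t, ENNReal.ofReal (M.survival π t s) := by
  have hm : ∀ t, Measurable fun x : ℕ → Option S => extend (1 : S → ℝ) (x t) := fun t =>
    (Measurable.of_discrete (f := extend (1 : S → ℝ))).comp (measurable_pi_apply t)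
  have h : ∀ᵐ x ∂M.pathMeasure π s, hittingTime x = ∑' t, extend (1 : S → ℝ) (x t) := by
    filter_upwards [M.ae_absorbing π s] with x hx using hittingTime_eq_tsum hx
  rw [expTime, lintegral_congr_ae h, lintegral_tsum fun t => (hm t).aemeasurable]
  exact tsum_congr fun t => M.lintegral_extend π s t zero_le_one

lemma tendsto_survival {π : S → A} (hπ : M.IsProper π) (s : S) :
    Tendsto (fun t => M.survival π t s) atTop (𝓝 0) := by
  have hm : ∀ t, Measurable fun x : ℕ → Option S => extend (1 : S → ℝ) (x t) := fun t =>
    (Measurable.of_discrete (f := extend (1 : S → ℝ))).comp (measurable_pi_apply t)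
  have hle : ∀ y : Option S, extend (1 : S → ℝ) y ≤ 1 := by
    intro y; cases y <;> simp [extend]
  have h : Tendsto (fun t => ∫⁻ x, extend (1 : S → ℝ) (x t) ∂M.pathMeasure π s) atTop
      (𝓝 (∫⁻ _, 0 ∂M.pathMeasure π s)) := by
    refine tendsto_lintegral_of_dominated_convergence (fun _ => 1) hm
      (fun t => ae_of_all _ fun x => hle _) (by simp) ?_
    filter_upwards [hπ s, M.ae_absorbing π s] with x ⟨T, hT⟩ hx
    refine tendsto_const_nhds.congr' ?_
    filter_upwards [eventually_ge_atTop T] with t ht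
    have : x t = none := by
      induction t, ht using Nat.le_induction with
      | base => exact hT
      | succ u _ ih => exact hx u ih
    rw [this]; rfl
  simp only [lintegral_zero] at h
  have h' : ∀ t, ∫⁻ x, extend (1 : S → ℝ) (x t) ∂M.pathMeasure π s =
      ENNReal.ofReal (M.survival π t s) := fun t => M.lintegral_extend π s t zero_le_one
  simp_rw [h'] at h
  have := (ENNReal.tendsto_toReal ENNReal.zero_ne_top).comp h
  refine this.congr fun t => ?_
  simp [ENNReal.toReal_ofReal (M.survival_nonneg π t s)]

lemma iterate_transit_mono (π : S → A) (t : ℕ) {v w : S → ℝ} (h : v ≤ w) :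
    (M.transit π)^[t] v ≤ (M.transit π)^[t] w :=
  Monotone.iterate (fun _ _ h => M.transit_mono π h) t h

lemma iterate_transit_smul (π : S → A) (t : ℕ) (c : ℝ) (v : S → ℝ) :
    (M.transit π)^[t] (c • v) = c • (M.transit π)^[t] v := by
  induction t generalizing v with
  | zero => rfl
  | succ t ih => rw [Function.iterate_succ_apply, transit_smul, ih, Function.iterate_succ_apply]

/-- A vector that decreases by at least `c` in expectation bounds `c` times the hitting time. -/
lemma sum_survival_le (π : S → A) {c : ℝ} {v : S → ℝ} (hv : 0 ≤ v)
    (h : ∀ s, c + M.transit π v s ≤ v s) (T : ℕ) (s : S) :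
    c * ∑ t ∈ Finset.range T, M.survival π t s ≤ v s := by
  -- Iterating the drift inequality T times telescopes; the remainder is nonnegative and is dropped
  -- at the end.
  have key : ∀ T : ℕ, c • ∑ t ∈ Finset.range T, M.survival π t + (M.transit π)^[T] v ≤ v := by
    intro T
    induction T with
    | zero => simp
    | succ T ih =>
      have h1 : c • (1 : S → ℝ) + M.transit π v ≤ v := fun s => by simpa using h s
      have h2 := M.iterate_transit_mono π T h1
      have h3 : (M.transit π)^[T] (c • (1 : S → ℝ) + M.transit π v) =
          c • M.survival π T + (M.transit π)^[T + 1] v := by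
        have : ∀ (n : ℕ) (a b : S → ℝ), (M.transit π)^[n] (a + b) =
            (M.transit π)^[n] a + (M.transit π)^[n] b := by
          intro n
          induction n with
          | zero => intros; rfl
          | succ n ih => intro a b; simp only [Function.iterate_succ_apply, transit_add, ih]
        rw [this, iterate_transit_smul, ← Function.iterate_succ_apply]; rfl
      rw [h3] at h2
      refine le_trans ?_ ih
      rw [Finset.sum_range_succ, smul_add, add_assoc]
      exact add_le_add_right h2 _
  have h1 := key T s
  have h2 : 0 ≤ (M.transit π)^[T] v := by
    clear h1
    induction T with
    | zero => exact hv
    | succ T ih => rw [Function.iterate_succ_apply']; exact M.transit_nonneg π ih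
  have h3 := h2 s
  simp only [Pi.add_apply, Pi.smul_apply, Finset.sum_apply, smul_eq_mul, Pi.zero_apply] at h1 h3
  linarith

lemma expTime_le_of_drift (π : S → A) {c : ℝ} (hc : 0 < c) {v : S → ℝ} (hv : 0 ≤ v)
    (h : ∀ s, c + M.transit π v s ≤ v s) (s : S) :
    M.expTime π s ≤ ENNReal.ofReal (v s / c) := by
  rw [expTime_eq_tsum]
  refine ENNReal.tsum_le_of_sum_range_le fun T => ?_
  rw [← ENNReal.ofReal_sum_of_nonneg fun t _ => M.survival_nonneg π t s]
  apply ENNReal.ofReal_le_ofReal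
  rw [le_div_iff₀ hc, mul_comm]
  exact M.sum_survival_le π hv h T s

/-- By finiteness of the state space, some T makes all survival probabilities at most 1/2. The
truncated expected time v up to T then satisfies P_π v + 1 = v + (survival at T) ≤ v + 1/2, which is
a drift of 1/2. -/
lemma expTime_ne_top {π : S → A} (hπ : M.IsProper π) (s : S) : M.expTime π s ≠ ∞ := by
  have hev : ∀ᶠ t in atTop, ∀ s, M.survival π t s ≤ 1 / 2 := by
    rw [eventually_all]
    exact fun s => (M.tendsto_survival hπ s).eventually (eventually_le_nhds (by norm_num))
  obtain ⟨T, hT⟩ := hev.exists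
  let v : S → ℝ := ∑ t ∈ Finset.range T, M.survival π t
  have hv : 0 ≤ v := Finset.sum_nonneg fun t _ => M.survival_nonneg π t
  refine ne_top_of_le_ne_top ENNReal.ofReal_ne_top
    (M.expTime_le_of_drift π (c := 1 / 2) (by norm_num) hv (fun s => ?_) s)
  have h1 : M.transit π v = ∑ t ∈ Finset.range T, M.survival π (t + 1) := by
    rw [transit_sum]; exact Finset.sum_congr rfl fun t _ => (M.survival_succ π t).symm
  have h2 : M.transit π v + M.survival π 0 = v + M.survival π T := by
    rw [h1, ← Finset.sum_range_succ', Finset.sum_range_succ]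
  have h3 := congrFun h2 s
  have h4 := hT s
  simp only [Pi.add_apply, survival_zero, Pi.one_apply] at h3
  linarith

lemma one_le_expTime (π : S → A) (s : S) : 1 ≤ M.expTime π s := by
  rw [expTime_eq_tsum]
  refine le_trans ?_ (ENNReal.le_tsum 0)
  simp [survival_zero]

lemma diameter_ne_top {π : S → A} (hπ : M.IsProper π) : M.diameter ≠ ∞ := by
  have h : ∑ s, M.expTime π s ≠ ∞ := ENNReal.sum_ne_top.2 fun s _ => M.expTime_ne_top hπ s
  refine ne_top_of_le_ne_top h (iSup_le fun s => (iInf_le _ π).trans ?_)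
  exact Finset.single_le_sum (f := fun s => M.expTime π s) (fun _ _ => zero_le) (Finset.mem_univ s)

lemma one_le_diameter [Nonempty S] : 1 ≤ M.diameter :=
  (le_iInf fun π => M.one_le_expTime π (Classical.arbitrary S)).trans
    (le_iSup (fun s => ⨅ π : S → A, M.expTime π s) (Classical.arbitrary S))

end MDP

/-! ### Chernoff and Bernstein bounds for counts of independent samples. -/

section Chernoff

variable {Ω : Type*} [MeasurableSpace Ω] {P : Measure Ω} [IsProbabilityMeasure P]

lemma mgf_ite_le {B : Set Ω} [DecidablePred (· ∈ B)] (hB : MeasurableSet B) (t : ℝ) :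
    mgf (fun ω => if ω ∈ B then (1 : ℝ) else 0) P t ≤
      Real.exp (P.real B * (Real.exp t - 1)) := by
  have h : (fun ω => Real.exp (t * if ω ∈ B then (1 : ℝ) else 0)) =
      fun ω => 1 + B.indicator (fun _ => Real.exp t - 1) ω := by
    ext ω
    by_cases hω : ω ∈ B <;> simp [hω]
  rw [mgf, h, integral_add (integrable_const _) ((integrable_const _).indicator hB),
    integral_indicator hB]
  simp only [integral_const, smul_eq_mul, probReal_univ, measureReal_restrict_apply_univ]
  linarith [Real.add_one_le_exp (P.real B * (Real.exp t - 1))]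

variable {α : Type*} [MeasurableSpace α] [MeasurableSingletonClass α] [DecidableEq α]
  {X : ℕ → Ω → α} {p : ℝ} {y : α}

/-- Poisson-type bound: each Bernoulli factor 1 + p(eᵗ - 1) is at most exp(p(eᵗ - 1)). -/
lemma mgf_count_le (hX : ∀ k, Measurable (X k)) (hind : iIndepFun X P)
    (hp : ∀ k, P.real (X k ⁻¹' {y}) = p) (n : ℕ) (t : ℝ) :
    mgf (fun ω => ∑ k ∈ Finset.range n, if X k ω = y then (1 : ℝ) else 0) P t ≤
      Real.exp (n * (p * (Real.exp t - 1))) := by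
  let g : α → ℝ := fun z => if z = y then 1 else 0
  have hg : Measurable g := Measurable.ite (measurableSet_singleton y) measurable_const
    measurable_const
  have h1 : (fun ω => ∑ k ∈ Finset.range n, if X k ω = y then (1 : ℝ) else 0) =
      ∑ k ∈ Finset.range n, g ∘ X k := by
    ext ω; simp [g]
  rw [h1, (hind.comp (fun _ => g) fun _ => hg).mgf_sum (fun k => hg.comp (hX k))]
  calc ∏ k ∈ Finset.range n, mgf (g ∘ X k) P t
      ≤ ∏ k ∈ Finset.range n, Real.exp (p * (Real.exp t - 1)) := by
        refine Finset.prod_le_prod (fun _ _ => mgf_nonneg) fun k _ => ?_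
        rw [← hp k]
        let _ : DecidablePred (· ∈ X k ⁻¹' {y}) := fun ω => inferInstanceAs (Decidable (X k ω = y))
        exact mgf_ite_le (hX k (measurableSet_singleton y)) t
    _ = _ := by rw [Finset.prod_const, Finset.card_range, ← Real.exp_nat_mul]

lemma integrable_exp_count (hX : ∀ k, Measurable (X k)) (n : ℕ) (t : ℝ) :
    Integrable (fun ω => Real.exp
      (t * ∑ k ∈ Finset.range n, if X k ω = y then (1 : ℝ) else 0)) P := by
  have hm : Measurable fun ω => ∑ k ∈ Finset.range n, if X k ω = y then (1 : ℝ) else 0 :=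
    Finset.measurable_sum _ fun k _ =>
      Measurable.ite (hX k (measurableSet_singleton y)) measurable_const measurable_const
  refine Integrable.of_bound (hm.const_mul t).exp.aestronglyMeasurable (Real.exp (|t| * n)) (ae_of_all _ fun ω => ?_)
  have h0 : 0 ≤ ∑ k ∈ Finset.range n, if X k ω = y then (1 : ℝ) else 0 :=
    Finset.sum_nonneg fun _ _ => by split_ifs <;> norm_num
  have h1 : ∑ k ∈ Finset.range n, (if X k ω = y then (1 : ℝ) else 0) ≤ n := by
    calc _ ≤ ∑ k ∈ Finset.range n, (1 : ℝ) :=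
          Finset.sum_le_sum fun _ _ => by split_ifs <;> norm_num
      _ = n := by simp
  rw [Real.norm_eq_abs, Real.abs_exp, Real.exp_le_exp]
  exact mul_le_mul (le_abs_self t) h1 h0 (abs_nonneg t)

lemma count_upper_tail (hX : ∀ k, Measurable (X k)) (hind : iIndepFun X P)
    (hp : ∀ k, P.real (X k ⁻¹' {y}) = p) (n : ℕ) {t : ℝ} (ht : 0 ≤ t) (a : ℝ) :
    P.real {ω | n * a ≤ ∑ k ∈ Finset.range n, if X k ω = y then (1 : ℝ) else 0} ≤
      Real.exp (n * (-t * a + p * (Real.exp t - 1))) := by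
  refine (measure_ge_le_exp_mul_mgf _ ht (integrable_exp_count hX n t)).trans ?_
  refine (mul_le_mul_of_nonneg_left (mgf_count_le hX hind hp n t) (Real.exp_pos _).le).trans ?_
  rw [← Real.exp_add]
  exact (congrArg Real.exp (by ring)).le

lemma count_lower_tail (hX : ∀ k, Measurable (X k)) (hind : iIndepFun X P)
    (hp : ∀ k, P.real (X k ⁻¹' {y}) = p) (n : ℕ) {t : ℝ} (ht : 0 ≤ t) (a : ℝ) :
    P.real {ω | ∑ k ∈ Finset.range n, (if X k ω = y then (1 : ℝ) else 0) ≤ n * a} ≤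
      Real.exp (n * (t * a + p * (Real.exp (-t) - 1))) := by
  refine (measure_le_le_exp_mul_mgf (t := -t) _ (by linarith) (integrable_exp_count hX n _)).trans
    ?_
  refine (mul_le_mul_of_nonneg_left (mgf_count_le hX hind hp n _) (Real.exp_pos _).le).trans ?_
  rw [← Real.exp_add]
  exact (congrArg Real.exp (by ring)).le

/-- Follows from (1 - x + x²/2)(1 + x + x²/2) = 1 + x⁴/4 ≥ 1. -/
lemma exp_neg_le_quadratic {x : ℝ} (hx : 0 ≤ x) : Real.exp (-x) ≤ 1 - x + x ^ 2 / 2 := by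
  rw [Real.exp_neg]
  have h := Real.quadratic_le_exp_of_nonneg hx
  refine inv_le_of_inv_le₀ (by nlinarith [sq_nonneg (x - 1)]) (le_trans ?_ h)
  rw [inv_le_iff_one_le_mul₀ (by nlinarith [sq_nonneg (x - 1)])]
  nlinarith [sq_nonneg (x ^ 2)]

lemma exp_le_cubic {x : ℝ} (h0 : 0 ≤ x) (h1 : x ≤ 1) :
    Real.exp x ≤ 1 + x + x ^ 2 / 2 + x ^ 3 / 4 := by
  have h := Real.exp_bound' h0 h1 (n := 3) (by norm_num)
  norm_num [Finset.sum_range_succ, Nat.factorial] at h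
  nlinarith [pow_nonneg h0 3]

/-- The exponent of the upper Chernoff bound at Bernstein deviation. -/
lemma exists_upper_exponent {p l : ℝ} (hp : 0 ≤ p) (hl : 0 < l) :
    ∃ t, 0 ≤ t ∧ -t * (p + 2 * √(p * l) + 14 * l) + p * (Real.exp t - 1) ≤ -2 * l := by
  rcases le_or_gt (4 * l) p with h | h
  · obtain ⟨r, hr, rfl⟩ : ∃ r, 0 < r ∧ p = r ^ 2 :=
      ⟨√p, Real.sqrt_pos.2 (by linarith), (Real.sq_sqrt hp).symm⟩
    obtain ⟨q, hq, rfl⟩ : ∃ q, 0 < q ∧ l = q ^ 2 :=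
      ⟨√l, Real.sqrt_pos.2 hl, (Real.sq_sqrt hl.le).symm⟩
    have hqr : 2 * q ≤ r := by nlinarith
    have hs : √(r ^ 2 * q ^ 2) = r * q := by
      rw [← mul_pow, Real.sqrt_sq (by positivity)]
    have ht1 : 2 * q / r ≤ 1 := (div_le_one hr).2 hqr
    have ht0 : 0 ≤ 2 * q / r := by positivity
    -- The choice t = 2√(l/p) minimizes -2t√(pl) + pt²/2, with value -2l. The cubic remainder pt³/4
    -- = tl is absorbed by 14tl; the case assumption 4l ≤ p ensures t ≤ 1.
    refine ⟨2 * q / r, ht0, ?_⟩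
    have he := exp_le_cubic ht0 ht1
    rw [hs]
    set t := 2 * q / r with ht
    have htr : t * r = 2 * q := by rw [ht]; field_simp
    have h1 : r ^ 2 * (Real.exp t - 1) ≤ r ^ 2 * (t + t ^ 2 / 2 + t ^ 3 / 4) :=
      mul_le_mul_of_nonneg_left (by linarith) (by positivity)
    have h2 : r ^ 2 * (t + t ^ 2 / 2 + t ^ 3 / 4) =
        t * r ^ 2 + (t * r) ^ 2 / 2 + t * (t * r) ^ 2 / 4 := by ring
    have h3 : -t * (r ^ 2 + 2 * (r * q) + 14 * q ^ 2) =
        -(t * r ^ 2) - 2 * q * (t * r) - 14 * t * q ^ 2 := by ring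
    rw [h2, htr] at h1
    rw [h3, htr]
    nlinarith [mul_nonneg ht0 (sq_nonneg q)]
  · refine ⟨1, zero_le_one, ?_⟩
    have he : Real.exp 1 - 1 ≤ 2 := by linarith [Real.exp_one_lt_d9]
    nlinarith [Real.sqrt_nonneg (p * l), mul_le_mul_of_nonneg_left he hp]

/-- The exponent of the lower Chernoff bound at Bernstein deviation. -/
lemma exists_lower_exponent {p l : ℝ} (hp : 0 < p) (hl : 0 < l) :
    ∃ t, 0 ≤ t ∧ t * (p - 2 * √(p * l)) + p * (Real.exp (-t) - 1) ≤ -2 * l := by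
  obtain ⟨r, hr, rfl⟩ : ∃ r, 0 < r ∧ p = r ^ 2 :=
    ⟨√p, Real.sqrt_pos.2 (by linarith), (Real.sq_sqrt hp.le).symm⟩
  obtain ⟨q, hq, rfl⟩ : ∃ q, 0 < q ∧ l = q ^ 2 :=
    ⟨√l, Real.sqrt_pos.2 hl, (Real.sq_sqrt hl.le).symm⟩
  have hs : √(r ^ 2 * q ^ 2) = r * q := by
    rw [← mul_pow, Real.sqrt_sq (by positivity)]
  have ht0 : 0 ≤ 2 * q / r := by positivity
  refine ⟨2 * q / r, ht0, ?_⟩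
  have he := exp_neg_le_quadratic ht0
  rw [hs]
  set t := 2 * q / r with ht
  have htr : t * r = 2 * q := by rw [ht]; field_simp
  have h1 : r ^ 2 * (Real.exp (-t) - 1) ≤ r ^ 2 * (-t + t ^ 2 / 2) :=
    mul_le_mul_of_nonneg_left (by linarith) (by positivity)
  have h2 : r ^ 2 * (-t + t ^ 2 / 2) = -(t * r ^ 2) + (t * r) ^ 2 / 2 := by ring
  have h3 : t * (r ^ 2 - 2 * (r * q)) = t * r ^ 2 - 2 * q * (t * r) := by ring
  rw [h2, htr] at h1
  rw [h3, htr]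
  nlinarith

/-- Empirical Bernstein inequality for the frequency `f` of `y`. -/
lemma freq_deviation (hX : ∀ k, Measurable (X k)) (hind : iIndepFun X P)
    (hp : ∀ k, P.real (X k ⁻¹' {y}) = p) {n : ℕ} (hn : 1 ≤ n) {l : ℝ} (hl : 0 < l)
    {f : Ω → ℝ} (hf : ∀ ω, n * f ω = ∑ k ∈ Finset.range n, if X k ω = y then (1 : ℝ) else 0) :
    P {ω | 2 * √(f ω * l) + 14 * l < |f ω - p|} ≤ ENNReal.ofReal (2 * Real.exp (-2 * (n * l))) := by
  have hn0 : (0 : ℝ) < n := by exact_mod_cast hn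
  have hp0 : 0 ≤ p := hp 0 ▸ measureReal_nonneg
  have hf0 : ∀ ω, 0 ≤ f ω := fun ω => by
    have : 0 ≤ n * f ω := by
      rw [hf]; exact Finset.sum_nonneg fun _ _ => by split_ifs <;> norm_num
    exact nonneg_of_mul_nonneg_right this hn0
  obtain ⟨t, ht, hte⟩ := exists_upper_exponent hp0 hl
  have hup := count_upper_tail hX hind hp n ht (p + 2 * √(p * l) + 14 * l)
  have hup' := hup.trans (Real.exp_le_exp.2 (mul_le_mul_of_nonneg_left hte hn0.le))
  simp_rw [← hf] at hup'
  -- The condition 0 < p excludes p = 0, where the optimal exponent 2√(l/p) is undefined and no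
  -- underestimation can occur.
  have hlow : P.real {ω | 0 < p ∧ f ω ≤ p - 2 * √(p * l)} ≤ Real.exp (n * (-2 * l)) := by
    rcases hp0.eq_or_lt with h0 | h0
    · simp [← h0, Real.exp_nonneg]
    · obtain ⟨t, ht, hte⟩ := exists_lower_exponent h0 hl
      have h := (count_lower_tail hX hind hp n ht (p - 2 * √(p * l))).trans
        (Real.exp_le_exp.2 (mul_le_mul_of_nonneg_left hte hn0.le))
      simp_rw [← hf] at h
      refine le_trans (measureReal_mono fun ω hω => ?_) h
      exact mul_le_mul_of_nonneg_left hω.2 hn0.le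
  have hsub : {ω | 2 * √(f ω * l) + 14 * l < |f ω - p|} ⊆
      {ω | n * (p + 2 * √(p * l) + 14 * l) ≤ n * f ω} ∪ {ω | 0 < p ∧ f ω ≤ p - 2 * √(p * l)} := by
    intro ω hω
    simp only [Set.mem_ofPred_eq, Set.mem_union] at hω ⊢
    have hs := Real.sqrt_nonneg (f ω * l)
    rcases le_total p (f ω) with h | h
    · left
      rw [abs_of_nonneg (by linarith)] at hω
      have : √(p * l) ≤ √(f ω * l) :=
        Real.sqrt_le_sqrt (mul_le_mul_of_nonneg_right h hl.le)
      exact mul_le_mul_of_nonneg_left (by linarith) hn0.le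
    · right
      rw [abs_of_nonpos (by linarith)] at hω
      refine ⟨by linarith [hf0 ω], ?_⟩
      rw [Real.sqrt_mul (hf0 ω)] at hω
      rw [Real.sqrt_mul hp0]
      have e1 := Real.sq_sqrt hp0
      have e2 := Real.sq_sqrt (hf0 ω)
      have e3 := Real.sq_sqrt hl.le
      have g1 := Real.sqrt_nonneg p
      have g2 := Real.sqrt_nonneg (f ω)
      have g3 := Real.sqrt_pos.2 hl
      set a := √p
      set b := √(f ω)
      set q := √l
      by_contra hcon
      push Not at hcon
      -- The radius involves f while the lower tail involves p. If a² - b² < 2aq, then a ≤ b + 2q,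
      -- so a² - b² < 2bq + 4q², contradicting the deviation 2bq + 14q².
      have hab : a ≤ b + 2 * q := by
        by_contra hc
        push Not at hc
        nlinarith
      nlinarith
  refine (measure_mono hsub).trans ((measure_union_le _ _).trans ?_)
  rw [two_mul (Real.exp _), ENNReal.ofReal_add (Real.exp_nonneg _) (Real.exp_nonneg _)]
  have he : Real.exp (n * (-2 * l)) = Real.exp (-2 * (n * l)) := by ring_nf
  rw [he] at hup' hlow
  exact add_le_add
    ((ENNReal.le_ofReal_iff_toReal_le (measure_ne_top _ _) (Real.exp_nonneg _)).2 hup')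
    ((ENNReal.le_ofReal_iff_toReal_le (measure_ne_top _ _) (Real.exp_nonneg _)).2 hlow)

end Chernoff

/-! ### Accurate samples and elementary bounds on radii. -/

section Samples

variable {S A : Type*} [Fintype S] [Fintype A] [DecidableEq S]

/-- The realized samples `ξ` never leave the supports of the transition laws, and all empirical
frequencies are within half the confidence radius of the transition probabilities. -/
structure Accurate (M : MDP S A) (δ : ℝ) (ξ : S → A → ℕ → Option S) : Prop where
  close : ∀ s a n y, |M.p s a y - empirical (ξ s a) n y| ≤ radius δ ξ s a n y / 2
  support : ∀ s a n, M.p s a (ξ s a n) ≠ 0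

omit [Fintype S] in
lemma empirical_nonneg (x : ℕ → Option S) (n : ℕ) (y : Option S) : 0 ≤ empirical x n y := by
  unfold empirical; positivity

lemma sum_empirical_le (x : ℕ → Option S) (n : ℕ) : ∑ y, empirical x n y ≤ 1 := by
  unfold empirical
  rw [← Finset.sum_div, div_le_one (by positivity), ← Nat.cast_sum,
    ← Finset.card_eq_sum_card_fiberwise (t := Finset.univ) (by simp)]
  simp

lemma empirical_le_one (x : ℕ → Option S) (n : ℕ) (y : Option S) : empirical x n y ≤ 1 :=
  (Finset.single_le_sum (fun y _ => empirical_nonneg x n y) (Finset.mem_univ y)).trans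
    (sum_empirical_le x n)

-- This is where the assumption δ ≤ 1/2 for S = A = 1 enters: it keeps the logarithm at least log 2.
omit [DecidableEq S] in
lemma two_le_ratio {δ : ℝ} (h0 : 0 < δ) (h1 : δ < 1)
    (hm : 1 ≤ Fintype.card S * Fintype.card A)
    (hdeg : Fintype.card S * Fintype.card A = 1 → δ ≤ 1 / 2) (n : ℕ) :
    2 ≤ (Fintype.card S : ℝ) * Fintype.card A * (max 1 n : ℕ) / δ := by
  have hn : (1 : ℝ) ≤ (max 1 n : ℕ) := by exact_mod_cast le_max_left 1 n
  rw [le_div_iff₀ h0]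
  rcases hm.eq_or_lt with h | h
  · have h' : (Fintype.card S : ℝ) * Fintype.card A = 1 := by exact_mod_cast h.symm
    have := hdeg h.symm
    rw [h']; linarith
  · have h' : (2 : ℝ) ≤ (Fintype.card S : ℝ) * Fintype.card A := by exact_mod_cast h
    nlinarith

omit [DecidableEq S] in
lemma logTerm_ge {δ : ℝ} (h0 : 0 < δ) (h1 : δ < 1)
    (hm : 1 ≤ Fintype.card S * Fintype.card A)
    (hdeg : Fintype.card S * Fintype.card A = 1 → δ ≤ 1 / 2) (n : ℕ) :
    0.69 ≤ logTerm S A δ n := by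
  have h := Real.log_le_log (by norm_num) (two_le_ratio h0 h1 hm hdeg n)
  unfold logTerm
  linarith [Real.log_two_gt_d9]

lemma radius_eq (δ : ℝ) (ξ : S → A → ℕ → Option S) (s : S) (a : A) (n : ℕ) (y : Option S) :
    radius δ ξ s a n y =
      4 * √(empirical (ξ s a) n y * (logTerm S A δ n / (max 1 n : ℕ)))
        + 28 * (logTerm S A δ n / (max 1 n : ℕ)) := by
  unfold radius
  congr 2
  · congr 1; ring
  · ring

end Samples

/-! ### The accuracy event and its probability. -/

section Probability

variable {S A Ω : Type*} [Fintype S] [Fintype A] [DecidableEq S] [MeasurableSpace Ω]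
  {M : MDP S A} {P : Measure Ω} [IsProbabilityMeasure P] {X : S → A → ℕ → Ω → Option S} {δ : ℝ}

/-- For n > 9, Bernstein with l = log(SAn/δ)/n gives failure probability 2exp(-2nl) = 2(δ/(SAn))².
For n ≤ 9, half the radius is at least 14 · 0.69/9 > 1, so no deviation is possible. -/
lemma measure_deviation_le (hX : IsGenerativeModel M P X) (h0 : 0 < δ) (h1 : δ < 1)
    (hm : 1 ≤ Fintype.card S * Fintype.card A)
    (hdeg : Fintype.card S * Fintype.card A = 1 → δ ≤ 1 / 2) (s : S) (a : A) (y : Option S)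
    (n : ℕ) :
    P {ω | radius δ (fun s a n => X s a n ω) s a n y / 2 <
        |empirical (fun k => X s a k ω) n y - M.p s a y|} ≤
      ENNReal.ofReal (if 9 < n then
        2 * (δ / (Fintype.card S * Fintype.card A)) ^ 2 * ((n : ℝ) ^ 2)⁻¹ else 0) := by
  have hL := logTerm_ge h0 h1 hm hdeg n
  split_ifs with hn
  · have hn0 : (0 : ℝ) < n := by exact_mod_cast (show 0 < n by omega)
    have hmax : ((max 1 n : ℕ) : ℝ) = n := by rw [max_eq_right (by omega)]
    have hl : 0 < logTerm S A δ n / n := by positivity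
    have hind : iIndepFun (fun k => X s a k) P :=
      hX.indep.precomp (g := fun k : ℕ => (s, a, k)) (fun i j h => by simpa using h)
    have hp : ∀ k, P.real (X s a k ⁻¹' {y}) = M.p s a y := fun k => by
      rw [Measure.real, hX.law, ENNReal.toReal_ofReal (M.p_nonneg s a y)]
    have h := freq_deviation (fun k => hX.measurable s a k) hind hp (n := n) (by omega) hl
      (f := fun ω => empirical (fun k => X s a k ω) n y) (fun ω => by
        simp only [empirical, hmax, Finset.card_filter, Nat.cast_sum, Nat.cast_ite, Nat.cast_one,
          Nat.cast_zero]
        field_simp)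
    have hmr : (0 : ℝ) < (Fintype.card S : ℝ) * Fintype.card A := by exact_mod_cast hm
    have he : 2 * Real.exp (-2 * (n * (logTerm S A δ n / n))) =
        2 * (δ / (Fintype.card S * Fintype.card A)) ^ 2 * ((n : ℝ) ^ 2)⁻¹ := by
      rw [mul_div_cancel₀ _ hn0.ne', logTerm, hmax, neg_mul, Real.exp_neg, two_mul (Real.log _),
        Real.exp_add, Real.exp_log (by positivity)]
      field_simp
    rw [he] at h
    refine le_trans (measure_mono fun ω hω => ?_) h
    simp only [Set.mem_ofPred_eq, radius_eq, hmax] at hω ⊢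
    linarith
  · have hlt : ((max 1 n : ℕ) : ℝ) ≤ 9 := by exact_mod_cast max_le (by norm_num) (not_lt.1 hn)
    have hpos : (0 : ℝ) < (max 1 n : ℕ) := by positivity
    have hr : 0.075 ≤ logTerm S A δ n / (max 1 n : ℕ) := by
      rw [le_div_iff₀ hpos]; linarith
    have : {ω | radius δ (fun s a n => X s a n ω) s a n y / 2 <
        |empirical (fun k => X s a k ω) n y - M.p s a y|} = ∅ := by
      rw [Set.eq_empty_iff_forall_notMem]
      intro ω hω
      simp only [Set.mem_ofPred_eq, radius_eq] at hω
      have h2 := empirical_nonneg (fun k => X s a k ω) n y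
      have h3 := empirical_le_one (fun k => X s a k ω) n y
      have h4 := M.p_nonneg s a y
      have h5 : M.p s a y ≤ 1 := by
        rw [← M.sum_p s a]
        exact Finset.single_le_sum (fun y _ => M.p_nonneg s a y) (Finset.mem_univ y)
      have h6 : |empirical (fun k => X s a k ω) n y - M.p s a y| ≤ 1 :=
        abs_le.2 ⟨by linarith, by linarith⟩
      have h7 := Real.sqrt_nonneg
        (empirical (fun k => X s a k ω) n y * (logTerm S A δ n / (max 1 n : ℕ)))
      linarith
    simp [this]

lemma tsum_tail_le {c : ℝ} (hc : 0 ≤ c) :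
    ∑' n : ℕ, ENNReal.ofReal (if 9 < n then c * ((n : ℝ) ^ 2)⁻¹ else 0) ≤
      ENNReal.ofReal (c / 5) := by
  refine ENNReal.tsum_le_of_sum_range_le fun N => ?_
  rw [← ENNReal.ofReal_sum_of_nonneg fun n _ => by split_ifs <;> positivity]
  apply ENNReal.ofReal_le_ofReal
  rw [← Finset.sum_filter, ← Finset.mul_sum]
  have h : (Finset.range N).filter (9 < ·) = Finset.Ioo 9 N := by
    ext n; simp [and_comm]
  rw [h]
  have h2 := sum_Ioo_inv_sq_le (α := ℝ) 9 N
  calc c * ∑ i ∈ Finset.Ioo 9 N, ((i : ℝ) ^ 2)⁻¹ ≤ c * (1 / 5) :=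
        mul_le_mul_of_nonneg_left (h2.trans (by norm_num)) hc
    _ = c / 5 := by ring

/-- The samples of a generative model are accurate with probability at least `1 - δ`. -/
lemma exists_accurate_event [Nonempty S] [Nonempty A] (hX : IsGenerativeModel M P X) (h0 : 0 < δ)
    (h1 : δ < 1) (hdeg : Fintype.card S * Fintype.card A = 1 → δ ≤ 1 / 2) :
    ∃ E : Set Ω, MeasurableSet E ∧ ENNReal.ofReal (1 - δ) ≤ P E ∧
      ∀ ω ∈ E, Accurate M δ (fun s a n => X s a n ω) := by
  have hm : 1 ≤ Fintype.card S * Fintype.card A :=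
    Nat.mul_pos Fintype.card_pos Fintype.card_pos
  let dev : (S × A) × Option S → ℕ → Set Ω := fun i n =>
    {ω | radius δ (fun s a n => X s a n ω) i.1.1 i.1.2 n i.2 / 2 <
      |empirical (fun k => X i.1.1 i.1.2 k ω) n i.2 - M.p i.1.1 i.1.2 i.2|}
  let out : (S × A) × ℕ → Set Ω := fun i => {ω | M.p i.1.1 i.1.2 (X i.1.1 i.1.2 i.2 ω) = 0}
  let bad : Set Ω := (⋃ i, ⋃ n, dev i n) ∪ ⋃ i : S × A, ⋃ n, out (i, n)
  have hout : ∀ i, P (out i) = 0 := by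
    intro i
    have hsub : out i ⊆ ⋃ y ∈ {y | M.p i.1.1 i.1.2 y = 0}, X i.1.1 i.1.2 i.2 ⁻¹' {y} := by
      intro ω hω
      simp only [Set.mem_iUnion]
      exact ⟨_, hω, rfl⟩
    refine measure_mono_null hsub ?_
    rw [measure_biUnion_null_iff (Set.to_countable _)]
    intro y hy
    rw [hX.law, show M.p i.1.1 i.1.2 y = 0 from hy, ENNReal.ofReal_zero]
  have hmr : (1 : ℝ) ≤ (Fintype.card S : ℝ) * Fintype.card A := by exact_mod_cast hm
  have hbad : P bad ≤ ENNReal.ofReal δ := by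
    refine (measure_union_le _ _).trans ?_
    rw [measure_iUnion_null fun i => measure_iUnion_null fun n => hout (i, n), add_zero]
    refine (measure_iUnion_fintype_le P _).trans ?_
    set c : ℝ := 2 * (δ / (Fintype.card S * Fintype.card A)) ^ 2 with hc
    calc ∑ i, P (⋃ n, dev i n) ≤ ∑ i : (S × A) × Option S, ENNReal.ofReal (c / 5) :=
          Finset.sum_le_sum fun i _ => (measure_iUnion_le _).trans
            ((ENNReal.tsum_le_tsum fun n =>
              measure_deviation_le hX h0 h1 hm hdeg i.1.1 i.1.2 i.2 n).trans
              (tsum_tail_le (by positivity)))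
      _ = ENNReal.ofReal (((Fintype.card S * Fintype.card A) * (Fintype.card S + 1)) * (c / 5)) := by
          rw [Finset.sum_const, ← ENNReal.ofReal_nsmul]
          congr 1
          simp [Fintype.card_option, nsmul_eq_mul]
      _ ≤ ENNReal.ofReal δ := by
          apply ENNReal.ofReal_le_ofReal
          have hA : (1 : ℝ) ≤ Fintype.card A := by exact_mod_cast Fintype.card_pos (α := A)
          have hS : (1 : ℝ) ≤ Fintype.card S := by exact_mod_cast Fintype.card_pos (α := S)
          set m : ℝ := (Fintype.card S : ℝ) * Fintype.card A
          -- There are m(S+1) ≤ 2m² triples, each failing with probability at most (2/5)(δ/m)²; the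
          -- total is at most 4δ²/5 ≤ δ.
          have hSm : (Fintype.card S : ℝ) + 1 ≤ 2 * m := by nlinarith
          have hcm : c * m ^ 2 = 2 * δ ^ 2 := by rw [hc]; field_simp
          have hc0 : 0 ≤ c := by positivity
          have : m * (Fintype.card S + 1) * (c / 5) ≤ m * (2 * m) * (c / 5) := by gcongr
          nlinarith
  -- A measurable hull of the bad set has the same measure, so measurability of the bad set itself
  -- is not needed.
  refine ⟨(toMeasurable P bad)ᶜ, (measurableSet_toMeasurable _ _).compl, ?_, fun ω hω => ?_⟩
  · rw [prob_compl_eq_one_sub (measurableSet_toMeasurable _ _), measure_toMeasurable,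
      ENNReal.ofReal_sub _ h0.le, ENNReal.ofReal_one]
    exact tsub_le_tsub_left hbad 1
  · have hω' : ω ∉ bad := fun h => hω (subset_toMeasurable _ _ h)
    simp only [bad, Set.mem_union, Set.mem_iUnion, not_or, not_exists] at hω'
    refine ⟨fun s a n y => ?_, fun s a n => hω'.2 (s, a) n⟩
    rw [abs_sub_comm]
    exact not_lt.1 (hω'.1 ((s, a), y) n)

end Probability

/-! ### Optimism of extended value iteration and its greedy policy. -/

section ValueIteration

variable {S A : Type*} [Fintype S] [Fintype A] [DecidableEq S] {M : MDP S A} {δ : ℝ}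
  {ξ : S → A → ℕ → Option S}

lemma Accurate.p_mem_plausible (h : Accurate M δ ξ) (s : S) (a : A) (n : ℕ) :
    M.p s a ∈ plausible δ ξ s a n := by
  refine ⟨M.p_mem s a, fun y => ?_⟩
  have h1 := h.close s a n y
  have h2 := abs_nonneg (M.p s a y - empirical (ξ s a) n y)
  linarith

lemma plausible_value_nonneg {v : S → ℝ} (hv : 0 ≤ v) {s : S} {a : A} {n : ℕ} {q : Option S → ℝ}
    (hq : q ∈ plausible δ ξ s a n) : 0 ≤ ∑ s' : S, q (some s') * v s' :=
  Finset.sum_nonneg fun s' _ => mul_nonneg (hq.1.1 _) (hv s')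

lemma bddBelow_plausible_values {v : S → ℝ} (hv : 0 ≤ v) (s : S) (a : A) (n : ℕ) :
    BddBelow ((fun q : Option S → ℝ => ∑ s' : S, q (some s') * v s') '' plausible δ ξ s a n) := by
  refine ⟨0, ?_⟩
  rintro _ ⟨q, hq, rfl⟩
  exact plausible_value_nonneg hv hq

lemma bellman_nonneg {v : S → ℝ} (hv : 0 ≤ v) (N : S → A → ℕ) :
    0 ≤ bellman δ ξ N (fun _ _ => 1) v := by
  intro s
  refine Real.iInf_nonneg fun a => add_nonneg zero_le_one (Real.sInf_nonneg ?_)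
  rintro _ ⟨q, hq, rfl⟩
  exact plausible_value_nonneg hv hq

/-- Accuracy is used to make the plausible set nonempty; otherwise its `sInf` would be the default
0. -/
lemma Accurate.bellman_mono (h : Accurate M δ ξ) (N : S → A → ℕ) {v w : S → ℝ} (hv : 0 ≤ v)
    (hvw : v ≤ w) :
    bellman δ ξ N (fun _ _ => 1) v ≤ bellman δ ξ N (fun _ _ => 1) w := by
  intro s
  refine ciInf_mono (Set.finite_range _).bddBelow fun a => add_le_add_right ?_ 1
  refine le_csInf ⟨_, M.p s a, h.p_mem_plausible s a _, rfl⟩ ?_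
  rintro _ ⟨q, hq, rfl⟩
  refine (csInf_le (bddBelow_plausible_values hv s a _) ⟨q, hq, rfl⟩).trans ?_
  exact Finset.sum_le_sum fun s' _ => mul_le_mul_of_nonneg_left (hvw s') (hq.1.1 _)

lemma Accurate.bellman_le (h : Accurate M δ ξ) (N : S → A → ℕ) {v : S → ℝ} (hv : 0 ≤ v)
    (π : S → A) (s : S) :
    bellman δ ξ N (fun _ _ => 1) v s ≤ 1 + M.transit π v s :=
  (ciInf_le (Set.finite_range _).bddBelow (π s)).trans
    (add_le_add_right
      (csInf_le (bddBelow_plausible_values hv s _ _) ⟨_, h.p_mem_plausible s (π s) _, rfl⟩) 1)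

lemma eviIter_succ (N : S → A → ℕ) (j : ℕ) :
    eviIter δ ξ N (fun _ _ => 1) (j + 1) =
      bellman δ ξ N (fun _ _ => 1) (eviIter δ ξ N (fun _ _ => 1) j) :=
  Function.iterate_succ_apply' _ _ _

lemma eviIter_nonneg (N : S → A → ℕ) (j : ℕ) : 0 ≤ eviIter δ ξ N (fun _ _ => 1) j := by
  induction j with
  | zero => exact le_rfl
  | succ j ih => rw [eviIter_succ]; exact bellman_nonneg ih N

lemma Accurate.eviIter_monotone (h : Accurate M δ ξ) (N : S → A → ℕ) :
    Monotone (eviIter δ ξ N (fun _ _ => 1)) := by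
  refine monotone_nat_of_le_succ fun j => ?_
  induction j with
  | zero => exact eviIter_nonneg N 1
  | succ j ih =>
    have := h.bellman_mono N (eviIter_nonneg N j) ih
    rwa [← eviIter_succ, ← eviIter_succ] at this

/-- Optimism: the true law competes in the inner minimum and π in the outer one, so each Bellman
step stays below 1 + P_π. -/
lemma Accurate.eviIter_le_sum (h : Accurate M δ ξ) (N : S → A → ℕ) (π : S → A) (j : ℕ) :
    eviIter δ ξ N (fun _ _ => 1) j ≤ ∑ t ∈ Finset.range j, M.survival π t := by
  induction j with
  | zero => exact le_rfl
  | succ j ih =>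
    intro s
    rw [eviIter_succ]
    refine (h.bellman_le N (eviIter_nonneg N j) π s).trans ?_
    have h1 := M.transit_mono π ih s
    rw [MDP.transit_sum] at h1
    rw [Finset.sum_range_succ', Pi.add_apply, MDP.survival_zero, Pi.one_apply, add_comm]
    simp_rw [MDP.survival_succ]
    linarith

/-- Every iterate is a lower bound on the diameter. -/
lemma Accurate.eviIter_le_diameter (h : Accurate M δ ξ) (hD : M.diameter ≠ ∞) (N : S → A → ℕ)
    (j : ℕ) (s : S) : eviIter δ ξ N (fun _ _ => 1) j s ≤ M.diameter.toReal := by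
  have h1 : ENNReal.ofReal (eviIter δ ξ N (fun _ _ => 1) j s) ≤ M.diameter := by
    refine le_trans (le_iInf fun π => ?_)
      (le_iSup (fun s => ⨅ π : S → A, M.expTime π s) s)
    rw [MDP.expTime_eq_tsum]
    refine le_trans ?_ (ENNReal.sum_le_tsum (Finset.range j))
    rw [← ENNReal.ofReal_sum_of_nonneg fun t _ => M.survival_nonneg π t s]
    have := h.eviIter_le_sum N π j s
    rw [Finset.sum_apply] at this
    exact ENNReal.ofReal_le_ofReal this
  exact (ENNReal.ofReal_le_iff_le_toReal hD).1 h1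

/-- The iterates increase and are bounded by D, hence converge. So the `sInf` in `evi` is attained
rather than a default value. -/
lemma Accurate.exists_eviIter_diff_le (h : Accurate M δ ξ) (hD : M.diameter ≠ ∞)
    (N : S → A → ℕ) {μ : ℝ} (hμ : 0 < μ) :
    ∃ j, ‖eviIter δ ξ N (fun _ _ => 1) (j + 1) - eviIter δ ξ N (fun _ _ => 1) j‖ ≤ μ := by
  have hconv : ∀ s, Tendsto (fun j => eviIter δ ξ N (fun _ _ => 1) (j + 1) s -
      eviIter δ ξ N (fun _ _ => 1) j s) atTop (𝓝 0) := by
    intro s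
    have hmono : Monotone fun j => eviIter δ ξ N (fun _ _ => 1) j s :=
      fun i j hij => h.eviIter_monotone N hij s
    have ht := tendsto_atTop_ciSup hmono
      ⟨M.diameter.toReal, by rintro _ ⟨j, rfl⟩; exact h.eviIter_le_diameter hD N j s⟩
    simpa using (ht.comp (tendsto_add_atTop_nat 1)).sub ht
  have hev : ∀ᶠ j in atTop, ∀ s, |eviIter δ ξ N (fun _ _ => 1) (j + 1) s -
      eviIter δ ξ N (fun _ _ => 1) j s| ≤ μ := by
    rw [eventually_all]
    intro s
    have := (hconv s).abs
    rw [abs_zero] at this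
    exact this.eventually (eventually_le_nhds hμ)
  obtain ⟨j, hj⟩ := hev.exists
  exact ⟨j, (pi_norm_le_iff_of_nonneg hμ.le).2 hj⟩

lemma evi_nonneg (N : S → A → ℕ) (μ : ℝ) : 0 ≤ evi δ ξ N (fun _ _ => 1) μ :=
  eviIter_nonneg N _

lemma Accurate.norm_evi_le (h : Accurate M δ ξ) (hD : M.diameter ≠ ∞) (N : S → A → ℕ) (μ : ℝ) :
    ‖evi δ ξ N (fun _ _ => 1) μ‖ ≤ M.diameter.toReal := by
  refine (pi_norm_le_iff_of_nonneg ENNReal.toReal_nonneg).2 fun s => ?_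
  rw [Real.norm_of_nonneg (evi_nonneg N μ s)]
  exact h.eviIter_le_diameter hD N _ s

lemma Accurate.bellman_evi_le (h : Accurate M δ ξ) (hD : M.diameter ≠ ∞) (N : S → A → ℕ) {μ : ℝ}
    (hμ : 0 < μ) (s : S) :
    bellman δ ξ N (fun _ _ => 1) (evi δ ξ N (fun _ _ => 1) μ) s ≤
      evi δ ξ N (fun _ _ => 1) μ s + μ := by
  have hne : {j | ‖eviIter δ ξ N (fun _ _ => 1) (j + 1) - eviIter δ ξ N (fun _ _ => 1) j‖ ≤ μ}
      |>.Nonempty := h.exists_eviIter_diff_le hD N hμ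
  have hj := Nat.sInf_mem hne
  have h1 := (abs_le.1 ((norm_le_pi_norm _ s).trans hj)).2
  rw [eviIter_succ, Pi.sub_apply] at h1
  unfold evi
  linarith

/-- On accurate samples, the true laws and any plausible ones value a vector almost equally. -/
lemma Accurate.value_le (h : Accurate M δ ξ) {s : S} {a : A} {n : ℕ} {η : ℝ}
    (hη : ∑ y, radius δ ξ s a n y ≤ η / 2) {q : Option S → ℝ} (hq : q ∈ plausible δ ξ s a n)
    {v : S → ℝ} (hv : 0 ≤ v) :
    ∑ s', M.p s a (some s') * v s' ≤ ∑ s', q (some s') * v s' + 3 / 8 * (η * ‖v‖) := by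
  -- Both laws have total mass 1, so v, extended by 0 at the goal, may be centred at ‖v‖/2, which
  -- halves its sup norm. The constant is 3/8 = (3/2)·(1/2)·(1/2): true law to empirical to
  -- plausible, the test η/2, and centring.
  let w : Option S → ℝ := fun y => y.elim 0 v
  have hw : ∀ y, |w y - ‖v‖ / 2| ≤ ‖v‖ / 2 := by
    intro y
    have h0 := norm_nonneg v
    cases y with
    | none => simp only [w, Option.elim]; rw [abs_le]; constructor <;> linarith
    | some s' =>
      have h1 := hv s'
      have h2 := norm_le_pi_norm v s'
      rw [Real.norm_of_nonneg h1] at h2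
      simp only [w, Option.elim, Pi.zero_apply] at h1 ⊢
      rw [abs_le]; constructor <;> linarith
  have hpq : ∀ y, |M.p s a y - q y| ≤ 3 / 2 * radius δ ξ s a n y := by
    intro y
    have h1 := h.close s a n y
    have h2 := hq.2 y
    have h3 := abs_sub_le (M.p s a y) (empirical (ξ s a) n y) (q y)
    rw [abs_sub_comm (empirical (ξ s a) n y)] at h3
    linarith
  have e1 : ∑ s', M.p s a (some s') * v s' - ∑ s', q (some s') * v s' =
      ∑ y, (M.p s a y - q y) * (w y - ‖v‖ / 2) := by
    simp_rw [mul_sub, sub_mul, Finset.sum_sub_distrib, ← Finset.sum_mul]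
    rw [M.sum_p s a, hq.1.2, Fintype.sum_option, Fintype.sum_option]
    simp [w]
  have e2 : ∑ y, (M.p s a y - q y) * (w y - ‖v‖ / 2) ≤
      ∑ y, 3 / 2 * radius δ ξ s a n y * (‖v‖ / 2) := by
    refine Finset.sum_le_sum fun y _ => (le_abs_self _).trans ?_
    rw [abs_mul]
    exact mul_le_mul (hpq y) (hw y) (abs_nonneg _) ((abs_nonneg _).trans (hpq y))
  rw [← Finset.sum_mul, ← Finset.mul_sum] at e2
  have e3 : 3 / 2 * (∑ y, radius δ ξ s a n y) * (‖v‖ / 2) ≤ 3 / 2 * (η / 2) * (‖v‖ / 2) := by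
    gcongr
  linarith

/-- The greedy policy of extended value iteration decreases its value vector in expectation. -/
lemma Accurate.exists_greedy [Nonempty A] (h : Accurate M δ ξ) (hD : M.diameter ≠ ∞)
    (N : S → A → ℕ) {η μ : ℝ} (hμ : 0 < μ)
    (hη : ∀ s a, ∑ y, radius δ ξ s a (N s a) y ≤ η / 2) :
    ∃ π : S → A, ∀ s,
      (1 - μ - 3 / 8 * (η * ‖evi δ ξ N (fun _ _ => 1) μ‖)) +
        M.transit π (evi δ ξ N (fun _ _ => 1) μ) s ≤ evi δ ξ N (fun _ _ => 1) μ s := by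
  set v := evi δ ξ N (fun _ _ => 1) μ with hv
  have hv0 : 0 ≤ v := evi_nonneg N μ
  choose π hπ using fun s => exists_eq_ciInf_of_finite (f := fun a : A => (1 : ℝ) +
    sInf ((fun q : Option S → ℝ => ∑ s' : S, q (some s') * v s') '' plausible δ ξ s a (N s a)))
  refine ⟨π, fun s => ?_⟩
  have h1 : (1 : ℝ) + sInf ((fun q : Option S → ℝ => ∑ s' : S, q (some s') * v s') ''
      plausible δ ξ s (π s) (N s (π s))) ≤ v s + μ :=
    (hπ s).trans_le (h.bellman_evi_le hD N hμ s)
  have h2 : M.transit π v s - 3 / 8 * (η * ‖v‖) ≤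
      sInf ((fun q : Option S → ℝ => ∑ s' : S, q (some s') * v s') ''
        plausible δ ξ s (π s) (N s (π s))) := by
    -- The bound is uniform over plausible laws, so the inner infimum need not be attained.
    refine le_csInf ⟨_, M.p s (π s), h.p_mem_plausible s (π s) _, rfl⟩ ?_
    rintro _ ⟨q, hq, rfl⟩
    have := h.value_le (hη s (π s)) hq hv0
    simp only [MDP.transit]
    linarith
  linarith

lemma Accurate.diameter_le [Nonempty A] (h : Accurate M δ ξ) (hD : M.diameter ≠ ∞)
    (N : S → A → ℕ) {η μ : ℝ} (hμ : 0 < μ)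
    (hη : ∀ s a, ∑ y, radius δ ξ s a (N s a) y ≤ η / 2)
    (hc : 0 < 1 - μ - 3 / 8 * (η * ‖evi δ ξ N (fun _ _ => 1) μ‖)) :
    M.diameter.toReal ≤ ‖evi δ ξ N (fun _ _ => 1) μ‖ /
      (1 - μ - 3 / 8 * (η * ‖evi δ ξ N (fun _ _ => 1) μ‖)) := by
  obtain ⟨π, hπ⟩ := h.exists_greedy hD N hμ hη
  refine ENNReal.toReal_le_of_le_ofReal (div_nonneg (norm_nonneg _) hc.le) ?_
  refine iSup_le fun s => (iInf_le _ π).trans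
    ((M.expTime_le_of_drift π hc (evi_nonneg N μ) hπ s).trans ?_)
  gcongr
  exact (Real.le_norm_self _).trans (norm_le_pi_norm _ s)

end ValueIteration

/-- The inflation factor of the output compensates precision and model error. -/
lemma le_inflated {ε x V : ℝ} (hε : 0 < ε) (hε1 : ε ≤ 1) (hx : 0 ≤ x) (hxε : x ≤ ε) (hV : 0 ≤ V) :
    0 < 1 - ε / 2 - 3 / 8 * x ∧
      V / (1 - ε / 2 - 3 / 8 * x) ≤ (1 + 2 * x * (1 + ε)) * (1 + ε) * V := by
  have hc : 0 < 1 - ε / 2 - 3 / 8 * x := by linarith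
  refine ⟨hc, ?_⟩
  rw [div_le_iff₀ hc]
  have hy0 : 0 ≤ x * (1 + ε) := by positivity
  have hy2 : x * (1 + ε) ≤ 2 := by nlinarith
  set y := x * (1 + ε) with hy
  have h1 : 1 ≤ (1 - ε / 2) * (1 + ε) := by nlinarith
  set α := (1 - ε / 2) * (1 + ε) with hα
  have h2 : (1 + 2 * x * (1 + ε)) * (1 + ε) * (1 - ε / 2 - 3 / 8 * x) =
      (1 + 2 * y) * (α - 3 / 8 * y) := by rw [hy, hα]; ring
  -- Since α ≥ 1, the product is at least 1 + (13/8)y - (3/4)y², which is at least 1 for 0 ≤ y ≤ 2.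
  have h3 : 1 ≤ (1 + 2 * y) * (α - 3 / 8 * y) := by nlinarith
  nlinarith

/-! ### Bounds on the maximal support size. -/

section Branching

variable {S A : Type*} [Fintype S] [Fintype A] (M : MDP S A)

namespace MDP

lemma ncard_support_le_branching (s : S) (a : A) :
    (Function.support (M.p s a)).ncard ≤ M.branching :=
  Finset.le_sup (f := fun sa : S × A => (Function.support (M.p sa.1 sa.2)).ncard)
    (Finset.mem_univ (s, a))

lemma one_le_branching [Nonempty S] [Nonempty A] : 1 ≤ M.branching := by
  obtain ⟨s⟩ := ‹Nonempty S›
  obtain ⟨a⟩ := ‹Nonempty A›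
  refine le_trans ?_ (M.ncard_support_le_branching s a)
  refine (Set.ncard_pos (Set.toFinite _)).2 ?_
  by_contra hne
  rw [Set.not_nonempty_iff_eq_empty, Function.support_eq_empty_iff] at hne
  have := M.sum_p s a
  simp [hne] at this

lemma branching_le : M.branching ≤ Fintype.card S + 1 := by
  refine Finset.sup_le fun sa _ => ?_
  refine (Set.ncard_le_card _).trans ?_
  simp [Nat.card_eq_fintype_card, Fintype.card_option]

end MDP

end Branching

/-! ### Sample complexity and termination of the loop. -/

section Counts

variable {S A : Type*} [Fintype S] [Fintype A] [DecidableEq S] {M : MDP S A} {ε δ W₀ : ℝ}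
  {ξ : S → A → ℕ → Option S}

/-- Cauchy–Schwarz over the true support, which contains every sample and has at most Γ elements;
this yields Γ instead of S in the leading term. -/
lemma Accurate.sum_sqrt_empirical_le (h : Accurate M δ ξ) (s : S) (a : A) (n : ℕ) :
    ∑ y, √(empirical (ξ s a) n y) ≤ √(M.branching) := by
  classical
  let T : Finset (Option S) := Finset.univ.filter fun y => M.p s a y ≠ 0
  have hT : (T.card : ℝ) ≤ M.branching := by
    have : T.card = (Function.support (M.p s a)).ncard := by
      rw [← Set.ncard_coe_finset]; congr 1; ext y; simp [T]
    exact_mod_cast this.le.trans (M.ncard_support_le_branching s a)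
  have hzero : ∀ y, y ∉ T → empirical (ξ s a) n y = 0 := by
    intro y hy
    have hy' : M.p s a y = 0 := by simpa [T] using hy
    have : (Finset.range n).filter (fun k => ξ s a k = y) = ∅ := by
      refine Finset.filter_eq_empty_iff.2 fun k _ hk => h.support s a k ?_
      rw [hk, hy']
    simp [empirical, this]
  have h1 : ∑ y, √(empirical (ξ s a) n y) = ∑ y ∈ T, √(empirical (ξ s a) n y) := by
    symm
    exact Finset.sum_subset (Finset.subset_univ _) fun y _ hy => by simp [hzero y hy]
  rw [h1]
  apply Real.le_sqrt_of_sq_le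
  calc (∑ y ∈ T, √(empirical (ξ s a) n y)) ^ 2
      ≤ T.card * ∑ y ∈ T, √(empirical (ξ s a) n y) ^ 2 := sq_sum_le_card_mul_sum_sq
    _ = T.card * ∑ y ∈ T, empirical (ξ s a) n y := by
        congr 1
        exact Finset.sum_congr rfl fun y _ => Real.sq_sqrt (empirical_nonneg _ _ _)
    _ ≤ T.card * 1 := by
        gcongr
        exact (Finset.sum_le_sum_of_subset_of_nonneg (Finset.subset_univ _)
          fun y _ _ => empirical_nonneg _ _ _).trans (sum_empirical_le _ _)
    _ ≤ M.branching := by rwa [mul_one]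

lemma Accurate.sum_radius_le (h : Accurate M δ ξ) (s : S) (a : A) (n : ℕ) :
    ∑ y, radius δ ξ s a n y ≤
      4 * √(M.branching * (logTerm S A δ n / (max 1 n : ℕ)))
        + 28 * (Fintype.card S + 1) * (logTerm S A δ n / (max 1 n : ℕ)) := by
  simp_rw [radius_eq, Real.sqrt_mul (empirical_nonneg _ _ _)]
  rw [Real.sqrt_mul (Nat.cast_nonneg _), Finset.sum_add_distrib, ← Finset.mul_sum,
    ← Finset.sum_mul, Finset.sum_const, Finset.card_univ, Fintype.card_option, nsmul_eq_mul]
  have h1 := mul_le_mul_of_nonneg_right (h.sum_sqrt_empirical_le s a n)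
    (Real.sqrt_nonneg (logTerm S A δ n / (max 1 n : ℕ)))
  push_cast at h1 ⊢
  linarith

/-- Removes n from inside the logarithm: log(rx) = log(x/(2B)) + log(2Br), and each term is at most
x/(2B). -/
lemma log_mul_le_div {B r x : ℝ} (hB : 0 < B) (hr : 0 < r) (hx : 0 < x)
    (h : 2 * B * Real.log (2 * B * r) ≤ x) : Real.log (r * x) ≤ x / B := by
  have e : r * x = x / (2 * B) * (2 * B * r) := by field_simp
  rw [e, Real.log_mul (by positivity) (by positivity)]
  have h1 := Real.log_le_sub_one_of_pos (show 0 < x / (2 * B) by positivity)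
  have h2 : Real.log (2 * B * r) ≤ x / (2 * B) := by
    rw [le_div_iff₀ (by positivity)]; linarith
  have h3 : x / B = x / (2 * B) + x / (2 * B) := by field_simp; ring
  linarith

/-- Up to a logarithm, the number of samples needed for accuracy `η`. -/
def sampleScale (M : MDP S A) (η : ℝ) : ℝ :=
  256 * M.branching / η ^ 2 + 112 * (Fintype.card S + 1) / η

/-- A number of samples at each pair that suffices for accuracy `η`. -/
def sampleBound (M : MDP S A) (δ η : ℝ) : ℕ :=
  ⌈2 * sampleScale M η *
    Real.log (2 * sampleScale M η * ((Fintype.card S : ℝ) * Fintype.card A / δ))⌉₊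

omit [DecidableEq S] in
lemma sampleScale_ge [Nonempty S] [Nonempty A] (M : MDP S A) {η : ℝ} (hη : 0 < η)
    (hη1 : η ≤ 1) : 256 ≤ sampleScale M η := by
  have hΓ : (1 : ℝ) ≤ M.branching := by exact_mod_cast M.one_le_branching
  have h1 : 256 ≤ 256 * (M.branching : ℝ) / η ^ 2 := by
    rw [le_div_iff₀ (by positivity)]; nlinarith
  have h2 : 0 ≤ 112 * ((Fintype.card S : ℝ) + 1) / η := by positivity
  unfold sampleScale
  linarith

omit [DecidableEq S] in
lemma one_le_ratio [Nonempty S] [Nonempty A] (h0 : 0 < δ) (h1 : δ < 1) :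
    1 ≤ (Fintype.card S : ℝ) * Fintype.card A / δ := by
  have hm : (1 : ℝ) ≤ (Fintype.card S : ℝ) * Fintype.card A := by
    exact_mod_cast Nat.mul_pos Fintype.card_pos Fintype.card_pos
  rw [le_div_iff₀ h0]; linarith

omit [DecidableEq S] in
lemma one_le_log_sampleScale [Nonempty S] [Nonempty A] (M : MDP S A) (h0 : 0 < δ) (h1 : δ < 1)
    {η : ℝ} (hη : 0 < η) (hη1 : η ≤ 1) :
    1 ≤ Real.log (2 * sampleScale M η * ((Fintype.card S : ℝ) * Fintype.card A / δ)) := by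
  have hB := sampleScale_ge M hη hη1
  have hr := one_le_ratio (S := S) (A := A) h0 h1
  rw [Real.le_log_iff_exp_le (by positivity)]
  have := Real.exp_one_lt_d9
  nlinarith

lemma Accurate.sum_radius_le_of_sampleBound_le [Nonempty S] [Nonempty A] (h : Accurate M δ ξ)
    (h0 : 0 < δ) (h1 : δ < 1) {η : ℝ} (hη : 0 < η) (hη1 : η ≤ 1) {n : ℕ}
    (hn : sampleBound M δ η ≤ n) (s : S) (a : A) : ∑ y, radius δ ξ s a n y ≤ η / 2 := by
  have hB := sampleScale_ge M hη hη1
  have hr := one_le_ratio (S := S) (A := A) h0 h1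
  have hlog := one_le_log_sampleScale M h0 h1 hη hη1
  have hn' := Nat.ceil_le.1 hn
  have hn1 : (1 : ℝ) ≤ n := by nlinarith
  have hn0 : (0 : ℝ) < n := by linarith
  have hmax : ((max 1 n : ℕ) : ℝ) = n := by
    rw [max_eq_right (by exact_mod_cast hn1)]
  have hL := log_mul_le_div (by linarith) (by linarith) hn0 hn'
  have hlT : logTerm S A δ n =
      Real.log ((Fintype.card S : ℝ) * Fintype.card A / δ * n) := by
    unfold logTerm; rw [hmax]; congr 1; ring
  have hl0 : 0 ≤ logTerm S A δ n / n := by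
    rw [hlT]; exact div_nonneg (Real.log_nonneg (by nlinarith)) hn0.le
  have hl : sampleScale M η * (logTerm S A δ n / n) ≤ 1 := by
    rw [hlT, ← mul_div_assoc, div_le_one hn0, mul_comm, ← le_div_iff₀ (by linarith)]
    exact hL
  refine (h.sum_radius_le s a n).trans ?_
  rw [hmax]
  set l := logTerm S A δ n / n
  have hΓ0 : (0 : ℝ) ≤ M.branching := Nat.cast_nonneg _
  -- Each summand of the scale times l is at most 1. The constants 256 = 16² and 112 = 4 · 28 make
  -- each part of the radius bound at most η/4.
  rw [sampleScale, add_mul] at hl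
  have a1 : 0 ≤ 256 * (M.branching : ℝ) / η ^ 2 * l := by positivity
  have a2 : 0 ≤ 112 * ((Fintype.card S : ℝ) + 1) / η * l := by positivity
  have b1 : 256 * (M.branching : ℝ) * l ≤ η ^ 2 := by
    have : 256 * (M.branching : ℝ) / η ^ 2 * l ≤ 1 := by linarith
    rwa [div_mul_eq_mul_div, div_le_one (by positivity)] at this
  have b2 : 112 * ((Fintype.card S : ℝ) + 1) * l ≤ η := by
    have : 112 * ((Fintype.card S : ℝ) + 1) / η * l ≤ 1 := by linarith
    rwa [div_mul_eq_mul_div, div_le_one hη] at this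
  have c1 : √(M.branching * l) ≤ η / 16 := by
    rw [Real.sqrt_le_left (by positivity)]; nlinarith
  linarith

lemma guess_pos (hW : W₀ = 1 / 2 ∨ W₀ = 1) (i : ℕ) : 0 < guess W₀ i := by
  unfold guess; rcases hW with rfl | rfl <;> positivity

lemma one_le_guess (hW : W₀ = 1 / 2 ∨ W₀ = 1) (i : ℕ) : 1 ≤ guess W₀ (i + 1) := by
  have : (1 : ℝ) ≤ 2 ^ i := one_le_pow₀ (by norm_num)
  unfold guess
  rw [pow_succ]
  rcases hW with rfl | rfl <;> linarith

lemma guess_succ (W₀ : ℝ) (i : ℕ) : guess W₀ (i + 1) = 2 * guess W₀ i := by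
  unfold guess; ring

lemma accuracy_pos (hε : 0 < ε) (hW : W₀ = 1 / 2 ∨ W₀ = 1) (i : ℕ) : 0 < accuracy ε W₀ i :=
  div_pos hε (guess_pos hW i)

lemma accuracy_le_one (hε1 : ε ≤ 1) (hW : W₀ = 1 / 2 ∨ W₀ = 1) (i : ℕ) :
    accuracy ε W₀ (i + 1) ≤ 1 := by
  have := one_le_guess hW i
  rw [accuracy, div_le_one (by linarith)]
  linarith

lemma accuracy_succ_le (hε : 0 < ε) (hW : W₀ = 1 / 2 ∨ W₀ = 1) (i : ℕ) :
    accuracy ε W₀ (i + 1) ≤ accuracy ε W₀ i := by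
  have := guess_pos hW i
  unfold accuracy
  rw [guess_succ]
  exact div_le_div_of_nonneg_left hε.le this (by linarith)

lemma Accurate.sum_radius_counts_le [Nonempty S] [Nonempty A] (h : Accurate M δ ξ)
    (h0 : 0 < δ) (h1 : δ < 1) (hε : 0 < ε) (hε1 : ε ≤ 1) (hW : W₀ = 1 / 2 ∨ W₀ = 1) (i : ℕ)
    (s : S) (a : A) :
    ∑ y, radius δ ξ s a (counts ε δ W₀ ξ (i + 1) s a) y ≤ accuracy ε W₀ (i + 1) / 2 := by
  have hne : {n | counts ε δ W₀ ξ i s a ≤ n ∧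
      ∑ y, radius δ ξ s a n y ≤ accuracy ε W₀ (i + 1) / 2}.Nonempty :=
    ⟨max (counts ε δ W₀ ξ i s a) (sampleBound M δ (accuracy ε W₀ (i + 1))), le_max_left _ _,
      h.sum_radius_le_of_sampleBound_le h0 h1 (accuracy_pos hε hW _)
        (accuracy_le_one hε1 hW i) (le_max_right _ _) s a⟩
  exact (Nat.sInf_mem hne).2

/-- Accuracies decrease, so a sample size passing the test of iteration i passes all earlier ones
and is always an admissible candidate. No monotonicity of the radii in n is needed. -/
lemma counts_le (hε : 0 < ε) (hW : W₀ = 1 / 2 ∨ W₀ = 1) (s : S) (a : A) {K : ℕ} (i : ℕ)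
    (hK : ∑ y, radius δ ξ s a K y ≤ accuracy ε W₀ i / 2) :
    counts ε δ W₀ ξ i s a ≤ K := by
  induction i with
  | zero => exact Nat.zero_le _
  | succ i ih =>
    refine Nat.sInf_le ⟨ih (hK.trans ?_), hK⟩
    linarith [accuracy_succ_le hε hW i]

lemma Accurate.counts_le_sampleBound [Nonempty S] [Nonempty A] (h : Accurate M δ ξ)
    (h0 : 0 < δ) (h1 : δ < 1) (hε : 0 < ε) (hε1 : ε ≤ 1) (hW : W₀ = 1 / 2 ∨ W₀ = 1) (i : ℕ)
    (s : S) (a : A) :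
    counts ε δ W₀ ξ (i + 1) s a ≤ sampleBound M δ (accuracy ε W₀ (i + 1)) :=
  counts_le hε hW s a (i + 1)
    (h.sum_radius_le_of_sampleBound_le h0 h1 (accuracy_pos hε hW _)
      (accuracy_le_one hε1 hW i) le_rfl s a)

/-- The number of calls made until iteration `i + 1` if its guess is at most twice the diameter. -/
lemma Accurate.totalSamples_le [Nonempty S] [Nonempty A] (h : Accurate M δ ξ)
    (h0 : 0 < δ) (h1 : δ < 1) (hε : 0 < ε) (hε1 : ε ≤ 1) (hW : W₀ = 1 / 2 ∨ W₀ = 1) (i : ℕ)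
    {D : ℝ} (hD : 1 ≤ D) (hg : guess W₀ (i + 1) ≤ 2 * D) :
    (totalSamples ε δ W₀ ξ (i + 1) : ℝ) ≤
      40000 * (D ^ 2 * M.branching * Fintype.card S * Fintype.card A / ε ^ 2
        + D * (Fintype.card S : ℝ) ^ 2 * Fintype.card A / ε)
        * (1 + Real.log (D * Fintype.card S * Fintype.card A / (ε * δ))) := by
  set η := accuracy ε W₀ (i + 1) with hηdef
  have hη : 0 < η := accuracy_pos hε hW _
  have hη1 : η ≤ 1 := accuracy_le_one hε1 hW i
  have hB := sampleScale_ge M hη hη1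
  have hlog := one_le_log_sampleScale M h0 h1 hη hη1
  have hA : (1 : ℝ) ≤ Fintype.card A := by exact_mod_cast Fintype.card_pos (α := A)
  have hS : (1 : ℝ) ≤ Fintype.card S := by exact_mod_cast Fintype.card_pos (α := S)
  have hΓ0 : (0 : ℝ) ≤ M.branching := Nat.cast_nonneg _
  have hΓ : (M.branching : ℝ) ≤ 2 * Fintype.card S := by
    have : (M.branching : ℝ) ≤ Fintype.card S + 1 := by exact_mod_cast M.branching_le
    linarith
  have htot : (totalSamples ε δ W₀ ξ (i + 1) : ℝ) ≤
      Fintype.card S * Fintype.card A * sampleBound M δ η := by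
    have : totalSamples ε δ W₀ ξ (i + 1) ≤ ∑ _s : S, ∑ _a : A, sampleBound M δ η :=
      Finset.sum_le_sum fun s _ => Finset.sum_le_sum fun a _ =>
        h.counts_le_sampleBound h0 h1 hε hε1 hW i s a
    simp only [Finset.sum_const, Finset.card_univ, smul_eq_mul] at this
    have h' : (totalSamples ε δ W₀ ξ (i + 1) : ℝ) ≤
      (Fintype.card S * (Fintype.card A * sampleBound M δ η) : ℕ) := by exact_mod_cast this
    push_cast at h'
    linarith
  -- Rounding up adds at most 1, which is below the scale times its logarithm; hence 3 instead of 2.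
  have hK : (sampleBound M δ η : ℝ) ≤ 3 * sampleScale M η *
      Real.log (2 * sampleScale M η * ((Fintype.card S : ℝ) * Fintype.card A / δ)) := by
    have := (Nat.ceil_lt_add_one (a := 2 * sampleScale M η *
      Real.log (2 * sampleScale M η * ((Fintype.card S : ℝ) * Fintype.card A / δ)))
      (by positivity)).le
    unfold sampleBound
    nlinarith
  have hinv : 1 / η ≤ 2 * D / ε := by
    rw [hηdef, accuracy, one_div_div]
    gcongr
  have hscale : sampleScale M η ≤ 1024 * (D ^ 2 * M.branching / ε ^ 2
      + D * Fintype.card S / ε) := by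
    have e1 : sampleScale M η = 256 * M.branching * (1 / η) ^ 2
        + 112 * (Fintype.card S + 1) * (1 / η) := by
      unfold sampleScale; ring
    have e2 : 256 * M.branching * (1 / η) ^ 2 ≤ 256 * M.branching * (2 * D / ε) ^ 2 := by
      gcongr
    have e3 : 112 * ((Fintype.card S : ℝ) + 1) * (1 / η) ≤
        112 * (2 * Fintype.card S) * (2 * D / ε) := by
      gcongr; linarith
    have e4 : 256 * M.branching * (2 * D / ε) ^ 2 = 1024 * (D ^ 2 * M.branching / ε ^ 2) := by
      ring
    have e5 : 112 * (2 * (Fintype.card S : ℝ)) * (2 * D / ε) =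
        448 * (D * Fintype.card S / ε) := by ring
    have e6 : 0 ≤ D * Fintype.card S / ε := by positivity
    linarith
  set σ : ℝ := (Fintype.card S : ℝ)
  set a : ℝ := (Fintype.card A : ℝ)
  set R : ℝ := D ^ 2 * M.branching / ε ^ 2 + D * σ / ε with hR
  have hRQ : σ * a * R = D ^ 2 * M.branching * σ * a / ε ^ 2 + D * σ ^ 2 * a / ε := by
    rw [hR]; ring
  set Z : ℝ := D * σ * a / (ε * δ) with hZ
  have hZ1 : 1 ≤ Z := by
    rw [hZ, le_div_iff₀ (by positivity)]
    have : ε * δ ≤ 1 := by nlinarith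
    have : 1 ≤ D * σ := by nlinarith
    nlinarith
  have hlZ : 0 ≤ Real.log Z := Real.log_nonneg hZ1
  have hDε : 1 ≤ D / ε := by rw [le_div_iff₀ hε]; linarith
  have hR3 : R ≤ 3 * σ * (D / ε) ^ 2 := by
    have e1 : D ^ 2 * M.branching / ε ^ 2 = M.branching * (D / ε) ^ 2 := by ring
    have e2 : D * σ / ε = σ * (D / ε) := by ring
    rw [hR, e1, e2]
    have e3 : M.branching * (D / ε) ^ 2 ≤ 2 * σ * (D / ε) ^ 2 := by gcongr
    have e4 : σ * (D / ε) ≤ σ * (D / ε) ^ 2 := by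
      gcongr; exact le_self_pow₀ hDε (by norm_num)
    linarith
  -- The argument of the logarithm is polynomial in Z, so its logarithm is at most 13 log 2 + 2 log
  -- Z ≤ 10(1 + log Z).
  have harg : 2 * sampleScale M η * (σ * a / δ) ≤ 2 ^ 13 * Z ^ 2 := by
    have e1 : Z = (D / ε) * σ * a * (1 / δ) := by rw [hZ]; field_simp
    have hδ : 1 ≤ 1 / δ := by rw [le_div_iff₀ h0]; linarith
    calc 2 * sampleScale M η * (σ * a / δ)
        ≤ 2 * (1024 * (3 * σ * (D / ε) ^ 2)) * (σ * a / δ) := by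
          gcongr; linarith
      _ = 6144 * ((D / ε) ^ 2 * σ ^ 2) * (a * (1 / δ)) := by ring
      _ ≤ 6144 * ((D / ε) ^ 2 * σ ^ 2) * (a * (1 / δ)) ^ 2 := by
          gcongr
          exact le_self_pow₀ (by nlinarith) (by norm_num)
      _ = 6144 * Z ^ 2 := by rw [e1]; ring
      _ ≤ 2 ^ 13 * Z ^ 2 := by gcongr; norm_num
  have hlogle : Real.log (2 * sampleScale M η * (σ * a / δ)) ≤ 10 * (1 + Real.log Z) := by
    refine (Real.log_le_log (by positivity) harg).trans ?_
    rw [Real.log_mul (by positivity) (by positivity), Real.log_pow, Real.log_pow]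
    have := Real.log_two_lt_d9
    push_cast
    linarith
  have hR0 : 0 ≤ R := by positivity
  calc (totalSamples ε δ W₀ ξ (i + 1) : ℝ) ≤ σ * a * sampleBound M δ η := htot
    _ ≤ σ * a * (3 * (1024 * R) * (10 * (1 + Real.log Z))) := by
        gcongr
        refine hK.trans ?_
        gcongr
    _ = 30720 * (σ * a * R) * (1 + Real.log Z) := by ring
    _ ≤ 40000 * (σ * a * R) * (1 + Real.log Z) := by gcongr; norm_num
    _ = _ := by rw [hRQ]

lemma Accurate.exists_stopsAfter [Nonempty S] (h : Accurate M δ ξ) (hD : M.diameter ≠ ∞)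
    (hW : W₀ = 1 / 2 ∨ W₀ = 1) :
    ∃ i, StopsAfter ε δ W₀ ξ (i + 1) ∧ guess W₀ (i + 1) ≤ 2 * M.diameter.toReal := by
  classical
  have hD1 : 1 ≤ M.diameter.toReal :=
    (ENNReal.ofReal_le_iff_le_toReal hD).1 (by simpa using M.one_le_diameter)
  have hle : ∀ i, ‖vec ε δ W₀ ξ i‖ ≤ M.diameter.toReal := fun i => h.norm_evi_le hD _ _
  have hex : ∃ i, ‖vec ε δ W₀ ξ (i + 1)‖ ≤ guess W₀ (i + 1) := by
    obtain ⟨i, hi⟩ := pow_unbounded_of_one_lt M.diameter.toReal (one_lt_two (α := ℝ))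
    refine ⟨i, (hle _).trans (hi.le.trans ?_)⟩
    have : (0 : ℝ) < 2 ^ i := by positivity
    unfold guess
    rw [pow_succ]
    rcases hW with rfl | rfl <;> linarith
  have hmin : ∀ i < Nat.find hex, guess W₀ (i + 1) < ‖vec ε δ W₀ ξ (i + 1)‖ :=
    fun i hi => not_le.1 (Nat.find_min hex hi)
  refine ⟨Nat.find hex, ⟨by omega, Nat.find_spec hex, fun i hi1 hi => ?_⟩, ?_⟩
  · obtain ⟨i, rfl⟩ := Nat.exists_eq_add_of_le' hi1
    exact hmin i (by omega)
  -- Stopping at once gives the guess 2W₀ ≤ 2 ≤ 2D; otherwise the preceding guess failed the test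
  -- and was below ‖v‖ ≤ D.
  · rcases hcase : Nat.find hex with _ | i
    · rw [guess]
      rcases hW with rfl | rfl <;> norm_num <;> linarith
    · have := (hmin i (by omega)).le.trans (hle _)
      rw [guess_succ]
      linarith

end Counts

end SSP

end

/-! ### Assembly of the lemma. -/

theorem lemma6 :
    ∃ (C : ℝ) (k : ℕ), 0 < C ∧
      ∀ (S A Ω : Type*) [Fintype S] [Nonempty S] [DecidableEq S] [Fintype A]
        [MeasurableSpace Ω] (M : SSP.MDP S A) (P : Measure Ω) [IsProbabilityMeasure P]
        (X : S → A → ℕ → Ω → Option S) (ε δ W₀ : ℝ),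
        (∃ π : S → A, M.IsProper π) →
        SSP.IsGenerativeModel M P X →
        0 < ε → ε ≤ 1 → 0 < δ → δ < 1 →
        (Fintype.card S * Fintype.card A = 1 → δ ≤ 1 / 2) →
        (W₀ = 1 / 2 ∨ W₀ = 1) →
        M.diameter ≠ ∞ ∧
        ∃ E : Set Ω, MeasurableSet E ∧ ENNReal.ofReal (1 - δ) ≤ P E ∧
          ∀ ω ∈ E, ∃ j : ℕ,
            SSP.StopsAfter ε δ W₀ (fun s a n => X s a n ω) j ∧
            (SSP.totalSamples ε δ W₀ (fun s a n => X s a n ω) j : ℝ) ≤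
              C * (M.diameter.toReal ^ 2 * M.branching * Fintype.card S * Fintype.card A / ε ^ 2
                  + M.diameter.toReal * (Fintype.card S : ℝ) ^ 2 * Fintype.card A / ε)
                * (1 + Real.log
                    (M.diameter.toReal * Fintype.card S * Fintype.card A / (ε * δ))) ^ k ∧
            (j : ℝ) ≤ Real.logb 2 (M.diameter.toReal * (1 + ε) / W₀) + 1 ∧
            M.diameter.toReal ≤ SSP.output ε δ W₀ (fun s a n => X s a n ω) j ∧
            SSP.output ε δ W₀ (fun s a n => X s a n ω) j ≤
              (1 + 2 * ε * (1 + ε)) * (1 + ε) * M.diameter.toReal := by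
  refine ⟨40000, 1, by norm_num, ?_⟩
  intro S A Ω _ _ _ _ _ M P _ X ε δ W₀ ⟨π, hπ⟩ hX hε hε1 hδ hδ1 hdeg hW
  have : Nonempty A := ⟨π (Classical.arbitrary S)⟩
  have hD := M.diameter_ne_top hπ
  have hD1 : 1 ≤ M.diameter.toReal :=
    (ENNReal.ofReal_le_iff_le_toReal hD).1 (by simpa using M.one_le_diameter)
  obtain ⟨E, hE, hPE, hacc⟩ := SSP.exists_accurate_event hX hδ hδ1 hdeg
  refine ⟨hD, E, hE, hPE, fun ω hω => ?_⟩
  have h := hacc ω hω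
  obtain ⟨i, hterm, hg⟩ := h.exists_stopsAfter (ε := ε) hD hW
  refine ⟨i + 1, hterm, ?_, ?_, ?_⟩
  · rw [pow_one]
    exact h.totalSamples_le hδ hδ1 hε hε1 hW i hD1 hg
  · have hW0 : 0 < W₀ := by rcases hW with rfl | rfl <;> norm_num
    -- The final guess 2 · W₀2ⁱ is at most 2D, so W₀2ⁱ ≤ D; the factor 1 + ε is slack.
    have h2 : (2 : ℝ) ^ i ≤ M.diameter.toReal * (1 + ε) / W₀ := by
      rw [le_div_iff₀ hW0]
      rw [SSP.guess_succ, SSP.guess] at hg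
      nlinarith
    have h3 := Real.logb_le_logb_of_le one_lt_two (by positivity) h2
    rw [Real.logb_pow, Real.logb_self_eq_one one_lt_two, mul_one] at h3
    push_cast
    linarith
  · have hgpos := SSP.guess_pos hW (i + 1)
    have hη := SSP.accuracy_pos hε hW (i + 1)
    have hVD : ‖SSP.vec ε δ W₀ (fun s a n => X s a n ω) (i + 1)‖ ≤ M.diameter.toReal :=
      h.norm_evi_le hD _ _
    have hV := norm_nonneg (SSP.vec ε δ W₀ (fun s a n => X s a n ω) (i + 1))
    -- The passed test ‖v‖ ≤ W combined with η = ε/W.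
    have hx : SSP.accuracy ε W₀ (i + 1) * ‖SSP.vec ε δ W₀ (fun s a n => X s a n ω) (i + 1)‖ ≤ ε := by
      calc _ ≤ SSP.accuracy ε W₀ (i + 1) * SSP.guess W₀ (i + 1) :=
            mul_le_mul_of_nonneg_left hterm.2.1 hη.le
        _ = ε := div_mul_cancel₀ _ hgpos.ne'
    have hx0 := mul_nonneg hη.le hV
    obtain ⟨hc, hle⟩ := SSP.le_inflated hε hε1 hx0 hx hV
    have hout : SSP.output ε δ W₀ (fun s a n => X s a n ω) (i + 1) =
        (1 + 2 * (SSP.accuracy ε W₀ (i + 1) *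
          ‖SSP.vec ε δ W₀ (fun s a n => X s a n ω) (i + 1)‖) * (1 + ε)) * (1 + ε) *
          ‖SSP.vec ε δ W₀ (fun s a n => X s a n ω) (i + 1)‖ := by
      rw [SSP.output]; ring
    rw [hout]
    refine ⟨(h.diameter_le hD _ (half_pos hε)
      (h.sum_radius_counts_le hδ hδ1 hε hε1 hW i) hc).trans hle, ?_⟩
    gcongr
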